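/- Let $T\ge 1$, let $\mathsf X\subset\mathbb R^{d_x}$, and let $\mathbb F$ be a class of measurable functions $\mathsf X\to\mathbb R^{d_y}$ on which $\rho(f,g)=\sup_{x\in\mathsf X}\|f(x)-g(x)\|_2$ is finite, so that $(\mathbb F,\rho)$ is a metric space. Let $f_\star\in\mathbb F$ and $$y_t=f_\star(x_t)+w_t,\qquad t=0,\dots,T-1,$$ where, for an increasing sequence of $\sigma$-fields $(\mathcal F_t)_{t\ge-1}$, each $x_t\in\mathsf X$ is $\mathcal F_{t-1}$-measurable, each $w_t\in\mathbb R^{d_y}$ is $\mathcal F_t$-measurable and integrable, $\mathbf E[w_t\mid\mathcal F_{t-1}]=0$, and $w_t$ is conditionally $\sigma_w^2$-subgaussian given $\mathcal F_{t-1}$ (with $\sigma_w\ge 0$), i.e. $\mathbf E[\exp(\lambda\langle w_t,s\rangle)\mid\mathcal F_{t-1}]\le\exp(\lambda^2\sigma_w^2/2)$ almost surely for all $\lambda\in\mathbb R$ and all unit vectors $s$. Let $P_\star$ be the joint law of $(x_0,\dots,x_{T-1},y_0,\dots,y_{T-1})$. Call a real random variable $U$ $\sigma^2$-subgaussian if $\mathbf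 E\exp(\lambda(U-\mathbf EU))\le\exp(\lambda^2\sigma^2/2)$ for all $\lambda\in\mathbb R$, and put $$\sigma_T^2(\mathbb F,P_\star)=\inf\Big\{\sigma^2:\ \tfrac1T\sum_{t=0}^{T-1}\|f(x_t)-g(x_t)\|_2\ \text{is }\sigma^2\text{-subgaussian under }P_\star\text{ for all }f,g\in\mathbb F\Big\},$$ which is assumed to be finite. Let $\mathcal N(\mathbb F,\rho,s)$ be the smallest cardinality of a subset of $\mathbb F$ such that every element of $\mathbb F$ is within $\rho$-distance $s$ of it, with $\log\mathcal N(\mathbb F,\rho,s)=\infty$ if there is no finite such set. Let $\hat f$ be a least squares estimator, i.e. a (possibly randomized, jointly measurable) random element of $\mathbb F$ with $$\hat f\in\operatorname*{argmin}_{f\in\mathbb F}\ \frac1T\sum_{t=0}^{T-1}\|y_t-f(x_t)\|_2^2\quad\text{almost surely},$$ and let $\xi$ be distributed according to the uniform mixture $\frac1T\sum_{t=0}^{T-1}\mathrm{Law}(x_t)$ and independent of all other randomness (the trajectory and $\hat f$). Then for any $\delta>0$, $\gamma>0$ and $\alpha\in[0,\gamma]$ with $\mathcal N(\mathbb F,\rho,\delta)<\infty$,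 $$\mathbf E\|\hat f(\xi)-f_\star(\xi)\|_2\le\sqrt{\frac{8\sigma_w^2\log\mathcal N(\mathbb F,\rho,\gamma)}{T}+128\,\alpha\,\sigma_w\sqrt{d_y}+64\frac{\sigma_w}{\sqrt T}\int_\alpha^\gamma\sqrt{\log\mathcal N(\mathbb F,\rho,s)}\,ds}+3\delta+\sqrt{2\sigma_T^2(\mathbb F,P_\star)\log\mathcal N(\mathbb F,\rho,\delta)},$$ where the first square root may be $+\infty$ (with $0\cdot\infty=0$ inside it). -/

import Mathlib

open MeasureTheory ProbabilityTheory
open scoped NNReal ENNReal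

/-- `metricEntropy F s = log 𝒩(F, ρ, s)` with values in `[0, ∞]`, where
`ρ(f, g) = sup_x ‖f x - g x‖` and `𝒩(F, ρ, s)` is the smallest cardinality of an `s`-cover of `F`
by elements of `F` (so the value is `∞` when there is no finite cover).
The type `UniformFun X E` is the space of functions `X → E` with the extended distance
`edist f g = ⨆ x, edist (f x) (g x)`. -/
noncomputable def metricEntropy {X E : Type*} [PseudoEMetricSpace E] (F : Set (X → E)) (s : ℝ≥0) :
    ℝ≥0∞ :=
  (ENNReal.log (Metric.coveringNumber s (UniformFun.ofFun '' F) : ℝ≥0∞)).toENNReal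

/-- The real random variable `U` is `v`-subgaussian under `P`:
`𝔼 exp (l (U - 𝔼 U)) ≤ exp (l² v / 2)` for all real `l`. Existence of the exponential moments,
hence of `𝔼 U`, is part of the definition. -/
def IsSubgaussian {Ω : Type*} {mΩ : MeasurableSpace Ω} (P : Measure Ω) (U : Ω → ℝ) (v : ℝ≥0) :
    Prop :=
  HasSubgaussianMGF (fun ω => U ω - ∫ ω', U ω' ∂P) v P

/-- The random vector `W` is conditionally `v`-subgaussian given the sub-σ-algebra `m`: almost
surely, `𝔼[exp (l ⟪W - 𝔼[W | m], s⟫) | m] ≤ exp (l² v / 2)`, for all unit vectors `s` and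
real `l`. -/
def IsCondSubgaussian {Ω : Type*} (m : MeasurableSpace Ω) {mΩ : MeasurableSpace Ω} (P : Measure Ω)
    {d : ℕ} (W : Ω → EuclideanSpace ℝ (Fin d)) (v : ℝ≥0) : Prop :=
  Integrable W P ∧
  ∀ s : EuclideanSpace ℝ (Fin d), ‖s‖ = 1 → ∀ l : ℝ,
    Integrable (fun ω => Real.exp (l * inner ℝ (W ω - (P[W | m]) ω) s)) P ∧
    P[fun ω => Real.exp (l * inner ℝ (W ω - (P[W | m]) ω) s) | m]
      ≤ᵐ[P] fun _ => Real.exp (l ^ 2 * v / 2)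

/-- The variance proxy `σ_T²(F, Q)`, where `Q` is the joint law of
`Z = ((x_0, …, x_{T-1}), (y_0, …, y_{T-1}))`: the infimum of all `v` such that
`(1 / T) ∑_t ‖f (x_t) - g (x_t)‖` is `v`-subgaussian under `Q` for all `f, g ∈ F`
(it is `∞` when there is no such `v`). -/
noncomputable def varianceProxy {T : ℕ} {X E : Type*} [MeasurableSpace X]
    [NormedAddCommGroup E] [MeasurableSpace E] (F : Set (X → E))
    (Q : Measure ((Fin T → X) × (Fin T → E))) : ℝ≥0∞ :=
  ⨅ (v : ℝ≥0) (_ : ∀ f ∈ F, ∀ g ∈ F,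
    IsSubgaussian Q (fun z => (1 / (T : ℝ)) * ∑ t : Fin T, ‖f (z.1 t) - g (z.1 t)‖) v), (v : ℝ≥0∞)

/-- `fhat` is a least squares estimate in `F` for the data `(xs, ys)`: it belongs to `F` and
minimizes `(1 / T) ∑_t ‖y_t - f (x_t)‖²` over `f ∈ F`. -/
def IsLSE {T : ℕ} {X E : Type*} [NormedAddCommGroup E] (F : Set (X → E))
    (xs : Fin T → X) (ys : Fin T → E) (fhat : X → E) : Prop :=
  fhat ∈ F ∧ IsMinOn (fun f => (1 / (T : ℝ)) * ∑ t : Fin T, ‖ys t - f (xs t)‖ ^ 2) F fhat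

/-- The uniform mixture `(1 / T) ∑_t Law(x_t)` of the laws of the covariates. -/
noncomputable def covariateMixture {Ω X : Type*} {mΩ : MeasurableSpace Ω} [MeasurableSpace X]
    (P : Measure Ω) {T : ℕ} (x : Fin T → Ω → X) : Measure X :=
  (T : ℝ≥0∞)⁻¹ • ∑ t : Fin T, P.map (x t)

/-! The error splits into the empirical error along the trajectory and the gap between empirical and
population `L¹` error; each is a maximal inequality over nets.

Empirical error. For predictable directions `h_t`, the exponential of `∑ (⟪w_t, h_t⟫ - σ²/2 ‖h_t‖²)`
has expectation at most one (`lintegral_exp_sum_le_one`). Minimality of the least squares fit gives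
`∑ ‖h_t‖² ≤ 2 ∑ ⟪w_t, h_t⟫` for `h_t = (fhat - fstar)(x_t)`. Write `fhat - fstar` as a link from
`fhat` to a fine net, a chain of dyadic links up to the net at scale `γ`, and an offset `g - fstar`
with `g` in that coarse net. The first costs `𝔼‖w‖ ≤ σ√(2d)` times the finest scale, the chain costs
the entropy integral (`exists_chain_dominating`), and for the last a fraction of the quadratic term
compensates the noise exactly, which yields the `σ² log 𝒩 / T` term (`exists_offset_dominating`).
The dominating variable bounds all of `F` at once, so it may be used at the data-dependent `fhat`.

Population error. For a fixed `g`, the error under the mixture is the mean of its empirical error.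
Replacing `fhat` by a point of a `δ`-net and bounding the largest downward deviation over that net
gives the `σ_T²` term (`lintegral_population_error_le`). Jensen and Cauchy-Schwarz turn the squared
empirical error into the `L¹` one. -/

/-! ### Exponential supermartingales. -/

/-- Restricted to `m`, the measure with density `Y` is dominated by `P`, since `Y` and its
conditional expectation have the same integrals over `m`-sets. Comparing the trimmed measures avoids
any integrability condition on `G`. -/
theorem lintegral_mul_ofReal_le_of_condExp_le_one {Ω : Type*} {m : MeasurableSpace Ω}
    {mΩ : MeasurableSpace Ω} {P : Measure Ω} [IsFiniteMeasure P] (hm : m ≤ mΩ) {Y : Ω → ℝ}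
    (hY : Integrable Y P) (hY0 : 0 ≤ Y) (hY1 : P[Y | m] ≤ᵐ[P] fun _ => 1) {G : Ω → ℝ≥0∞}
    (hG : Measurable[m] G) :
    ∫⁻ ω, G ω * ENNReal.ofReal (Y ω) ∂P ≤ ∫⁻ ω, G ω ∂P := by
  have hd : AEMeasurable (fun ω => ENNReal.ofReal (Y ω)) P := hY.1.aemeasurable.ennreal_ofReal
  have e1 : ∫⁻ ω, G ω * ENNReal.ofReal (Y ω) ∂P
      = ∫⁻ ω, G ω ∂(P.withDensity fun ω => ENNReal.ofReal (Y ω)) := by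
    rw [lintegral_withDensity_eq_lintegral_mul₀ hd (hG.mono hm le_rfl).aemeasurable]
    exact lintegral_congr fun ω => mul_comm _ _
  rw [e1, ← lintegral_trim hm hG, ← lintegral_trim hm hG]
  refine lintegral_mono' ?_ le_rfl
  refine Measure.le_iff.2 fun A hA => ?_
  rw [trim_measurableSet_eq hm hA, trim_measurableSet_eq hm hA, withDensity_apply _ (hm A hA),
    ← ofReal_integral_eq_lintegral_ofReal hY.integrableOn (.of_forall hY0),
    ← setIntegral_condExp hm hY hA]
  refine (ENNReal.ofReal_le_ofReal (setIntegral_mono_ae integrable_condExp.integrableOn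
    (integrable_const (1 : ℝ)).integrableOn hY1)).trans ?_
  simp [Measure.real]

theorem exists_tendsto_measurable_finite_range {Ω E : Type*} [MeasurableSpace Ω]
    [NormedAddCommGroup E] [MeasurableSpace E] [BorelSpace E] [SecondCountableTopology E]
    {h : Ω → E} (hh : Measurable h) :
    ∃ (s : ℕ → Ω → E) (R : ℕ → Finset E), (∀ n, Measurable (s n)) ∧ (∀ n ω, s n ω ∈ R n) ∧
      ∀ ω, Filter.Tendsto (fun n => s n ω) Filter.atTop (nhds (h ω)) :=
  ⟨fun n => hh.stronglyMeasurable.approx n, fun n => (hh.stronglyMeasurable.approx n).range,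
    fun n => (hh.stronglyMeasurable.approx n).measurable,
    fun n ω => (hh.stronglyMeasurable.approx n).mem_range_self ω,
    hh.stronglyMeasurable.tendsto_approx⟩

/-- The exponential supermartingale step, for a direction that is random but known in advance. -/
theorem IsCondSubgaussian.lintegral_mul_exp_le {Ω : Type*} {m : MeasurableSpace Ω}
    {mΩ : MeasurableSpace Ω} {P : Measure Ω} [IsProbabilityMeasure P] (hm : m ≤ mΩ) {d : ℕ}
    {W : Ω → EuclideanSpace ℝ (Fin d)} {v : ℝ≥0} (hW : IsCondSubgaussian m P W v)
    (hW_meas : Measurable W) (hW0 : P[W | m] =ᵐ[P] 0)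
    {h : Ω → EuclideanSpace ℝ (Fin d)} (hh : Measurable[m] h) {G : Ω → ℝ≥0∞}
    (hG : Measurable[m] G) :
    ∫⁻ ω, G ω * ENNReal.ofReal (Real.exp (inner ℝ (W ω) (h ω) - v / 2 * ‖h ω‖ ^ 2)) ∂P
      ≤ ∫⁻ ω, G ω ∂P := by
  have key : ∀ c : EuclideanSpace ℝ (Fin d), ∀ G : Ω → ℝ≥0∞, Measurable[m] G →
      ∫⁻ ω, G ω * ENNReal.ofReal (Real.exp (inner ℝ (W ω) c - v / 2 * ‖c‖ ^ 2)) ∂P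
        ≤ ∫⁻ ω, G ω ∂P := by
    intro c G hG
    by_cases hc : c = 0
    · simp [hc]
    have hn : ‖c‖ ≠ 0 := norm_ne_zero_iff.2 hc
    obtain ⟨hi, hle⟩ := hW.2 (‖c‖⁻¹ • c) (by rw [norm_smul, norm_inv, norm_norm, inv_mul_cancel₀ hn])
      ‖c‖
    have hae : (fun ω => Real.exp (‖c‖ * inner ℝ (W ω - (P[W | m]) ω) (‖c‖⁻¹ • c))) =ᵐ[P]
        fun ω => Real.exp (inner ℝ (W ω) c) := by
      filter_upwards [hW0] with ω hω
      rw [hω, Pi.zero_apply, sub_zero, real_inner_smul_right, ← mul_assoc, mul_inv_cancel₀ hn,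
        one_mul]
    have hi' := hi.congr hae
    have hle' := (condExp_congr_ae (m := m) hae).symm.le.trans hle
    refine lintegral_mul_ofReal_le_of_condExp_le_one hm
      (Y := fun ω => Real.exp (inner ℝ (W ω) c - v / 2 * ‖c‖ ^ 2)) ?_
      (fun ω => (Real.exp_pos _).le) ?_ hG
    · simpa only [Real.exp_sub] using hi'.div_const _
    · have e : (fun ω => Real.exp (inner ℝ (W ω) c - v / 2 * ‖c‖ ^ 2))
          = (Real.exp (v / 2 * ‖c‖ ^ 2))⁻¹ • fun ω => Real.exp (inner ℝ (W ω) c) := by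
        funext ω
        simp only [Real.exp_sub, Pi.smul_apply, smul_eq_mul]
        rw [div_eq_inv_mul]
      rw [e]
      filter_upwards [condExp_smul (μ := P) (Real.exp (v / 2 * ‖c‖ ^ 2))⁻¹
        (fun ω => Real.exp (inner ℝ (W ω) c)) m, hle'] with ω h1 h2
      rw [h1, Pi.smul_apply, smul_eq_mul, inv_mul_le_iff₀ (Real.exp_pos _), mul_one]
      refine h2.trans (le_of_eq ?_)
      congr 1
      ring
  -- The random direction is a limit of finitely valued ones. On each of their level sets, which lie
  -- in `m`, the direction is constant, so `key` applies with `G` cut off to that set; Fatou handles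
  -- the limit.
  obtain ⟨s, R, hs_meas, hsR, hs_lim⟩ := @exists_tendsto_measurable_finite_range _ _ m _ _ _ _ _ hh
  let F : ℕ → Ω → ℝ≥0∞ := fun n ω => G ω *
    ENNReal.ofReal (Real.exp (inner ℝ (W ω) (s n ω) - v / 2 * ‖s n ω‖ ^ 2))
  have hF_meas : ∀ n, Measurable (F n) := by
    intro n
    have h1 : Measurable (s n) := (hs_meas n).mono hm le_rfl
    have h2 : Measurable G := hG.mono hm le_rfl
    refine h2.mul (ENNReal.measurable_ofReal.comp (Real.measurable_exp.comp ?_))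
    exact (hW_meas.inner h1).sub ((h1.norm.pow_const 2).const_mul _)
  have hF_le : ∀ n, ∫⁻ ω, F n ω ∂P ≤ ∫⁻ ω, G ω ∂P := by
    intro n
    have hfib : ∀ c, MeasurableSet[m] (s n ⁻¹' {c}) := fun c => hs_meas n (measurableSet_singleton c)
    have hdec : ∀ H : Ω → ℝ≥0∞, ∫⁻ ω, H ω ∂P = ∑ c ∈ R n, ∫⁻ ω in s n ⁻¹' {c}, H ω ∂P := by
      intro H
      rw [← lintegral_biUnion_finset]
      · have : (⋃ c ∈ R n, s n ⁻¹' {c}) = Set.univ := by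
          ext ω; simpa using hsR n ω
        rw [this, setLIntegral_univ]
      · intro a _ b _ hab
        exact Disjoint.preimage _ (by simpa using hab)
      · exact fun c _ => hm _ (hfib c)
    rw [hdec (F n), hdec G]
    refine Finset.sum_le_sum fun c _ => ?_
    have hc : MeasurableSet (s n ⁻¹' {c}) := hm _ (hfib c)
    have e := key c ((s n ⁻¹' {c}).indicator G) (hG.indicator (hfib c))
    rw [lintegral_indicator hc] at e
    refine le_trans (le_of_eq ?_) e
    rw [← lintegral_indicator hc]
    refine lintegral_congr fun ω => ?_
    by_cases hω : ω ∈ s n ⁻¹' {c}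
    · have : s n ω = c := hω
      rw [Set.indicator_of_mem hω, Set.indicator_of_mem hω]
      simp only [F, this]
    · rw [Set.indicator_of_notMem hω, Set.indicator_of_notMem hω, zero_mul]
  have hlim : ∀ ω, Filter.Tendsto (fun n => F n ω) Filter.atTop (nhds (G ω *
      ENNReal.ofReal (Real.exp (inner ℝ (W ω) (h ω) - v / 2 * ‖h ω‖ ^ 2)))) := by
    intro ω
    have h1 := hs_lim ω
    refine ENNReal.Tendsto.const_mul (ENNReal.tendsto_ofReal
      ((Real.continuous_exp.tendsto _).comp ?_)) (Or.inl ?_)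
    · exact (tendsto_const_nhds.inner h1).sub ((h1.norm.pow 2).const_mul _)
    · exact (ENNReal.ofReal_pos.2 (Real.exp_pos _)).ne'
  calc _ = ∫⁻ ω, Filter.liminf (fun n => F n ω) Filter.atTop ∂P :=
        lintegral_congr fun ω => (hlim ω).liminf_eq.symm
    _ ≤ Filter.liminf (fun n => ∫⁻ ω, F n ω ∂P) Filter.atTop := lintegral_liminf_le hF_meas
    _ ≤ _ := Filter.liminf_le_of_frequently_le' (Filter.Frequently.of_forall hF_le)

/-- The last factor is peeled off by the one-step inequality with the previous exponential as the
weight `G`. Measurability is carried through the induction because it is what makes that weight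
admissible. -/
theorem lintegral_exp_sum_le_one {Ω E : Type*} {mΩ : MeasurableSpace Ω} {P : Measure Ω}
    [IsProbabilityMeasure P] [NormedAddCommGroup E] [InnerProductSpace ℝ E] [MeasurableSpace E]
    [BorelSpace E] [SecondCountableTopology E] (ℱ : Filtration ℕ mΩ) (v : ℝ≥0) :
    ∀ {T : ℕ} {w h : Fin T → Ω → E},
    (∀ t : Fin T, Measurable[ℱ ((t : ℕ) + 1)] (w t)) →
    (∀ t : Fin T, ∀ h : Ω → E, Measurable[ℱ (t : ℕ)] h → ∀ G : Ω → ℝ≥0∞, Measurable[ℱ (t : ℕ)] G →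
      ∫⁻ ω, G ω * ENNReal.ofReal (Real.exp (inner ℝ (w t ω) (h ω) - v / 2 * ‖h ω‖ ^ 2)) ∂P
        ≤ ∫⁻ ω, G ω ∂P) →
    (∀ t : Fin T, Measurable[ℱ (t : ℕ)] (h t)) →
    Measurable[ℱ T] (fun ω => ENNReal.ofReal
      (Real.exp (∑ t, (inner ℝ (w t ω) (h t ω) - v / 2 * ‖h t ω‖ ^ 2)))) ∧
    ∫⁻ ω, ENNReal.ofReal
      (Real.exp (∑ t, (inner ℝ (w t ω) (h t ω) - v / 2 * ‖h t ω‖ ^ 2))) ∂P ≤ 1 := by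
  intro T
  induction T with
  | zero => intro w h _ _ _; simp
  | succ T ih =>
    intro w h hw hstep hh
    obtain ⟨h1, h2⟩ := ih (w := fun t => w t.castSucc) (h := fun t => h t.castSucc)
      (fun t => hw t.castSucc) (fun t => hstep t.castSucc) (fun t => hh t.castSucc)
    have e : ∀ ω, ENNReal.ofReal
        (Real.exp (∑ t, (inner ℝ (w t ω) (h t ω) - v / 2 * ‖h t ω‖ ^ 2))) =
        ENNReal.ofReal (Real.exp (∑ t : Fin T, (inner ℝ (w t.castSucc ω) (h t.castSucc ω)
          - v / 2 * ‖h t.castSucc ω‖ ^ 2))) *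
        ENNReal.ofReal (Real.exp (inner ℝ (w (Fin.last T) ω) (h (Fin.last T) ω)
          - v / 2 * ‖h (Fin.last T) ω‖ ^ 2)) := by
      intro ω
      rw [Fin.sum_univ_castSucc, Real.exp_add, ENNReal.ofReal_mul (Real.exp_pos _).le]
    have hwl : Measurable[ℱ (T + 1)] (w (Fin.last T)) := by simpa using hw (Fin.last T)
    have hhl : Measurable[ℱ T] (h (Fin.last T)) := by simpa using hh (Fin.last T)
    have hle : ℱ T ≤ ℱ (T + 1) := ℱ.mono (Nat.le_succ T)
    simp only [e]
    refine ⟨(h1.mono hle le_rfl).mul (ENNReal.measurable_ofReal.comp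
      (Real.measurable_exp.comp ?_)), le_trans ?_ h2⟩
    · have hhl' : Measurable[ℱ (T + 1)] (h (Fin.last T)) := hhl.mono hle le_rfl
      have h3 : Measurable fun p : E × E => (inner ℝ p.1 p.2 - v / 2 * ‖p.2‖ ^ 2 : ℝ) := by fun_prop
      exact h3.comp (Measurable.prodMk hwl hhl')
    · have := hstep (Fin.last T) (h (Fin.last T)) (by simpa using hhl) _ (by simpa using h1)
      simpa using this

/-! ### Soft maximum and second moments. -/

/-- A finite family with a common bound on an exponential moment is dominated by one integrable
function, which is obtained from a soft maximum by `u ≤ exp (u - a) - 1 + a`. -/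
theorem exists_integrable_dominating {Ω β : Type*} {mΩ : MeasurableSpace Ω} {P : Measure Ω}
    [IsProbabilityMeasure P] (C : Finset β) {V : β → Ω → ℝ} (hV : ∀ k ∈ C, Measurable (V k))
    {μ c H : ℝ} (hμ : 0 < μ) (hcard : (C.card : ℝ) ≤ Real.exp H)
    (hexp : ∀ k ∈ C, ∫⁻ ω, ENNReal.ofReal (Real.exp (μ * V k ω)) ∂P ≤ ENNReal.ofReal (Real.exp c)) :
    ∃ R : Ω → ℝ, Integrable R P ∧ (∀ k ∈ C, ∀ ω, V k ω ≤ R ω) ∧ ∫ ω, R ω ∂P ≤ (H + c) / μ := by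
  have hint : ∀ k ∈ C, Integrable (fun ω => Real.exp (μ * V k ω)) P := by
    intro k hk
    refine ⟨(Real.measurable_exp.comp ((hV k hk).const_mul μ)).aestronglyMeasurable, ?_⟩
    rw [hasFiniteIntegral_iff_ofReal (.of_forall fun ω => (Real.exp_pos _).le)]
    exact (hexp k hk).trans_lt ENNReal.ofReal_lt_top
  have hle : ∀ k ∈ C, ∫ ω, Real.exp (μ * V k ω) ∂P ≤ Real.exp c := by
    intro k hk
    rw [integral_eq_lintegral_of_nonneg_ae (.of_forall fun ω => (Real.exp_pos _).le) (hint k hk).1]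
    exact ENNReal.toReal_le_of_le_ofReal (Real.exp_pos _).le (hexp k hk)
  have hsum : Integrable (fun ω => ∑ k ∈ C, Real.exp (μ * V k ω)) P := integrable_finsetSum C hint
  refine ⟨fun ω => (H + c - 1 + Real.exp (-(H + c)) * ∑ k ∈ C, Real.exp (μ * V k ω)) / μ,
    ((integrable_const _).add (hsum.const_mul _)).div_const _, ?_, ?_⟩
  · intro k hk ω
    rw [le_div_iff₀ hμ]
    have h1 : Real.exp (μ * V k ω) ≤ ∑ k ∈ C, Real.exp (μ * V k ω) :=
      Finset.single_le_sum (f := fun k => Real.exp (μ * V k ω)) (fun _ _ => (Real.exp_pos _).le) hk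
    have h2 := mul_le_mul_of_nonneg_left h1 (Real.exp_pos (-(H + c))).le
    rw [← Real.exp_add] at h2
    have h3 := Real.add_one_le_exp (-(H + c) + μ * V k ω)
    linarith
  · rw [integral_div, integral_add (integrable_const _) (hsum.const_mul _), integral_const,
      integral_const_mul, integral_finsetSum C hint]
    have h1 : ∑ k ∈ C, ∫ ω, Real.exp (μ * V k ω) ∂P ≤ Real.exp (H + c) := by
      refine (Finset.sum_le_sum hle).trans ?_
      rw [Finset.sum_const, nsmul_eq_mul, Real.exp_add]
      exact mul_le_mul_of_nonneg_right hcard (Real.exp_pos _).le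
    have h2 := mul_le_mul_of_nonneg_left h1 (Real.exp_pos (-(H + c))).le
    rw [← Real.exp_add, neg_add_cancel, Real.exp_zero] at h2
    have h3 : P.real Set.univ • (H + c - 1) = H + c - 1 := by simp
    rw [h3]
    refine div_le_div_of_nonneg_right ?_ hμ.le
    linarith

theorem sq_add_two_le_exp_add_exp_neg (u : ℝ) : u ^ 2 + 2 ≤ Real.exp u + Real.exp (-u) := by
  have h1 : |u / 2| ≤ |Real.sinh (u / 2)| := by
    rw [Real.abs_sinh]
    exact Real.self_le_sinh_iff.2 (abs_nonneg _)
  have h2 := sq_le_sq.2 h1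
  have h3 := Real.cosh_two_mul (u / 2)
  have h4 := Real.cosh_sq (u / 2)
  rw [mul_div_cancel₀ u two_ne_zero, Real.cosh_eq] at h3
  linarith

theorem lintegral_sq_le_of_lintegral_exp_le {Ω : Type*} {mΩ : MeasurableSpace Ω} {P : Measure Ω}
    [IsProbabilityMeasure P] {Y : Ω → ℝ} (hY : Measurable Y) {σ : ℝ} (hσ : 0 ≤ σ)
    (h : ∀ l : ℝ, ∫⁻ ω, ENNReal.ofReal (Real.exp (l * Y ω - σ ^ 2 / 2 * l ^ 2)) ∂P ≤ 1) :
    ∫⁻ ω, ENNReal.ofReal (Y ω ^ 2) ∂P ≤ ENNReal.ofReal (2 * σ ^ 2) := by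
  have h' : ∀ l : ℝ, ∫⁻ ω, ENNReal.ofReal (Real.exp (l * Y ω)) ∂P
      ≤ ENNReal.ofReal (Real.exp (σ ^ 2 / 2 * l ^ 2)) := by
    intro l
    have e : ∀ ω, ENNReal.ofReal (Real.exp (l * Y ω)) = ENNReal.ofReal (Real.exp (σ ^ 2 / 2 * l ^ 2))
        * ENNReal.ofReal (Real.exp (l * Y ω - σ ^ 2 / 2 * l ^ 2)) := by
      intro ω
      rw [← ENNReal.ofReal_mul (Real.exp_pos _).le, ← Real.exp_add]
      congr 2
      ring
    simp_rw [e]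
    rw [lintegral_const_mul _ (by fun_prop)]
    exact mul_le_of_le_one_right' (h l)
  -- Any `l > 0` with `l σ ≤ 1` works, and the `+ 1` covers `σ = 0`. Then `u ≤ 1/2`, so `exp u ≤ 1 /
  -- (1 - u) ≤ 1 + 2u`; this loses the factor 2 in `2 σ²`.
  set l : ℝ := (σ + 1)⁻¹ with hl
  have hl0 : 0 < l := by positivity
  have hls : l * σ ≤ 1 := by rw [hl, inv_mul_le_iff₀ (by positivity)]; linarith
  have hu : σ ^ 2 / 2 * l ^ 2 ≤ 1 / 2 := by nlinarith [mul_nonneg hl0.le hσ]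
  set u := σ ^ 2 / 2 * l ^ 2 with hudef
  have hu0 : 0 ≤ u := by positivity
  have hexp : Real.exp u ≤ 1 + 2 * u := by
    refine (Real.exp_bound_div_one_sub_of_interval hu0 (by linarith)).trans ?_
    rw [div_le_iff₀ (by linarith)]
    nlinarith
  have hpt : ∀ ω, ENNReal.ofReal (l ^ 2) * ENNReal.ofReal (Y ω ^ 2) + 2
      ≤ ENNReal.ofReal (Real.exp (l * Y ω)) + ENNReal.ofReal (Real.exp (-l * Y ω)) := by
    intro ω
    rw [← ENNReal.ofReal_mul (by positivity), ← ENNReal.ofReal_add (Real.exp_pos _).le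
      (Real.exp_pos _).le, show (2 : ℝ≥0∞) = ENNReal.ofReal 2 by simp,
      ← ENNReal.ofReal_add (by positivity) (by norm_num)]
    refine ENNReal.ofReal_le_ofReal ?_
    have := sq_add_two_le_exp_add_exp_neg (l * Y ω)
    rw [mul_pow] at this
    rwa [neg_mul]
  have hint := lintegral_mono (μ := P) hpt
  rw [lintegral_add_right _ measurable_const, lintegral_add_right _ (by fun_prop), lintegral_const,
    measure_univ, mul_one, lintegral_const_mul _ (by fun_prop)] at hint
  have h2 : ENNReal.ofReal (l ^ 2) * ∫⁻ ω, ENNReal.ofReal (Y ω ^ 2) ∂P + 2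
      ≤ ENNReal.ofReal (4 * u) + 2 := by
    refine hint.trans ((add_le_add (h' l) (h' (-l))).trans ?_)
    rw [show (2 : ℝ≥0∞) = ENNReal.ofReal 2 by simp, ← ENNReal.ofReal_add (Real.exp_pos _).le
      (Real.exp_pos _).le, ← ENNReal.ofReal_add (by positivity) (by norm_num), neg_sq]
    refine ENNReal.ofReal_le_ofReal ?_
    linarith
  have h3 := (ENNReal.add_le_add_iff_right (by norm_num)).1 h2
  have h4 : ENNReal.ofReal (4 * u) = ENNReal.ofReal (l ^ 2) * ENNReal.ofReal (2 * σ ^ 2) := by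
    rw [← ENNReal.ofReal_mul (by positivity), hudef]
    congr 1
    ring
  rw [h4] at h3
  exact (ENNReal.mul_le_mul_iff_right (by simpa using hl0.ne') ENNReal.ofReal_ne_top).1 h3

theorem lintegral_norm_sq_le {Ω : Type*} {mΩ : MeasurableSpace Ω} {P : Measure Ω}
    [IsProbabilityMeasure P] {d : ℕ} {W : Ω → EuclideanSpace ℝ (Fin d)} (hW : Measurable W) {σ : ℝ}
    (hσ : 0 ≤ σ) (h : ∀ c : EuclideanSpace ℝ (Fin d),
      ∫⁻ ω, ENNReal.ofReal (Real.exp (inner ℝ (W ω) c - σ ^ 2 / 2 * ‖c‖ ^ 2)) ∂P ≤ 1) :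
    ∫⁻ ω, ENNReal.ofReal (‖W ω‖ ^ 2) ∂P ≤ ENNReal.ofReal (2 * σ ^ 2 * d) := by
  have hc : ∀ i, Measurable fun ω => W ω i := fun i => by fun_prop
  have e : ∀ ω, ENNReal.ofReal (‖W ω‖ ^ 2) = ∑ i, ENNReal.ofReal (W ω i ^ 2) := by
    intro ω
    rw [EuclideanSpace.real_norm_sq_eq, ENNReal.ofReal_sum_of_nonneg fun i _ => sq_nonneg _]
  simp_rw [e]
  rw [lintegral_finsetSum _ fun i _ => by fun_prop]
  have hb : ∀ i, ∫⁻ ω, ENNReal.ofReal (W ω i ^ 2) ∂P ≤ ENNReal.ofReal (2 * σ ^ 2) := by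
    intro i
    refine lintegral_sq_le_of_lintegral_exp_le (hc i) hσ fun l => ?_
    have := h (l • EuclideanSpace.single i 1)
    simpa [real_inner_smul_right, EuclideanSpace.inner_single_right, norm_smul] using this
  refine (Finset.sum_le_sum fun i _ => hb i).trans ?_
  rw [Finset.sum_const, Finset.card_univ, Fintype.card_fin, nsmul_eq_mul, mul_comm,
    ENNReal.ofReal_mul (p := 2 * σ ^ 2) (by positivity), ENNReal.ofReal_natCast]

/-! ### Noise maxima over finite classes. -/

section NoiseMaxima

variable {Ω X E : Type*} {mΩ : MeasurableSpace Ω} {P : Measure Ω} [IsProbabilityMeasure P]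
  [MeasurableSpace X] [NormedAddCommGroup E] [InnerProductSpace ℝ E] [MeasurableSpace E]
  [BorelSpace E] [SecondCountableTopology E] {T : ℕ} {x : Fin T → Ω → X} {w : Fin T → Ω → E}
  {σ : ℝ}

/-- Maximal inequality for the martingale offset process over a finite class. -/
theorem exists_offset_dominating (hx : ∀ t, Measurable (x t)) (hw : ∀ t, Measurable (w t))
    (hσ : 0 < σ) (hnoise : ∀ k : X → E, Measurable k → ∫⁻ ω, ENNReal.ofReal (Real.exp
      (∑ t, (inner ℝ (w t ω) (k (x t ω)) - σ ^ 2 / 2 * ‖k (x t ω)‖ ^ 2))) ∂P ≤ 1)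
    {β : Type*} (C : Finset β) {k : β → X → E} (hk : ∀ b ∈ C, Measurable (k b)) {c H : ℝ}
    (hc : 0 < c) (hcard : (C.card : ℝ) ≤ Real.exp H) :
    ∃ R : Ω → ℝ, Integrable R P ∧ (∀ b ∈ C, ∀ ω,
      ∑ t, (2 * inner ℝ (w t ω) (k b (x t ω)) - c * ‖k b (x t ω)‖ ^ 2) ≤ R ω) ∧
      ∫ ω, R ω ∂P ≤ 2 * σ ^ 2 * H / c := by
  have hkx : ∀ b ∈ C, ∀ t, Measurable fun ω => k b (x t ω) := fun b hb t => (hk b hb).comp (hx t)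
  -- With this `μ`, the scaled offset process is exactly the supermartingale exponent in the
  -- direction `(c / σ²) • k b`, so its exponential moment is at most `exp 0`.
  obtain ⟨R, h1, h2, h3⟩ := exists_integrable_dominating (P := P) C
    (V := fun b ω => ∑ t, (2 * inner ℝ (w t ω) (k b (x t ω)) - c * ‖k b (x t ω)‖ ^ 2))
    (μ := c / (2 * σ ^ 2)) (c := 0) (H := H)
    (fun b hb => Finset.measurable_fun_sum _ fun t _ =>
      (((hw t).inner (hkx b hb t)).const_mul _).sub (((hkx b hb t).norm.pow_const 2).const_mul _))
    (by positivity) hcard (by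
      intro b hb
      refine le_trans (le_of_eq ?_) ((hnoise (fun u => (c / σ ^ 2) • k b u)
        ((hk b hb).const_smul (c / σ ^ 2))).trans (by simp))
      refine lintegral_congr fun ω => ?_
      congr 2
      rw [Finset.mul_sum]
      refine Finset.sum_congr rfl fun t _ => ?_
      rw [real_inner_smul_right, norm_smul, Real.norm_of_nonneg (by positivity)]
      field_simp)
  refine ⟨R, h1, h2, h3.trans (le_of_eq ?_)⟩
  field_simp
  ring

/-- Maximal inequality for the martingale process over a finite class of bounded functions. -/
theorem exists_process_dominating (hx : ∀ t, Measurable (x t)) (hw : ∀ t, Measurable (w t))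
    (hσ : 0 < σ) (hnoise : ∀ k : X → E, Measurable k → ∫⁻ ω, ENNReal.ofReal (Real.exp
      (∑ t, (inner ℝ (w t ω) (k (x t ω)) - σ ^ 2 / 2 * ‖k (x t ω)‖ ^ 2))) ∂P ≤ 1)
    {β : Type*} (C : Finset β) {k : β → X → E} (hk : ∀ b ∈ C, Measurable (k b)) {r H : ℝ}
    (hr : 0 < r) (hT : 0 < T) (hkr : ∀ b ∈ C, ∀ u, ‖k b u‖ ≤ r) (hH : 0 < H)
    (hcard : (C.card : ℝ) ≤ Real.exp H) :
    ∃ R : Ω → ℝ, Integrable R P ∧ (∀ b ∈ C, ∀ ω, ∑ t, inner ℝ (w t ω) (k b (x t ω)) ≤ R ω) ∧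
      ∫ ω, R ω ∂P ≤ σ * r * √(2 * H * T) := by
  have hkx : ∀ b ∈ C, ∀ t, Measurable fun ω => k b (x t ω) := fun b hb t => (hk b hb).comp (hx t)
  have hT' : (0 : ℝ) < T := by exact_mod_cast hT
  set q := √(2 * H * T) with hq
  have hq0 : 0 < q := by positivity
  have hq2 : q ^ 2 = 2 * H * T := Real.sq_sqrt (by positivity)
  -- The minimiser of `H / l + σ² r² T l / 2`.
  set l := q / (T * σ * r) with hl
  have hl0 : 0 < l := by positivity
  obtain ⟨R, h1, h2, h3⟩ := exists_integrable_dominating (P := P) C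
    (V := fun b ω => ∑ t, inner ℝ (w t ω) (k b (x t ω)))
    (μ := l) (c := σ ^ 2 / 2 * (l * r) ^ 2 * T) (H := H)
    (fun b hb => Finset.measurable_fun_sum _ fun t _ => (hw t).inner (hkx b hb t))
    hl0 hcard (by
      intro b hb
      have h4 : ∀ ω, ENNReal.ofReal (Real.exp (l * ∑ t, inner ℝ (w t ω) (k b (x t ω)))) ≤
          ENNReal.ofReal (Real.exp (σ ^ 2 / 2 * (l * r) ^ 2 * T)) * ENNReal.ofReal (Real.exp
            (∑ t, (inner ℝ (w t ω) (l • k b (x t ω)) - σ ^ 2 / 2 * ‖l • k b (x t ω)‖ ^ 2))) := by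
        intro ω
        rw [← ENNReal.ofReal_mul (Real.exp_pos _).le, ← Real.exp_add]
        refine ENNReal.ofReal_le_ofReal (Real.exp_le_exp.2 ?_)
        rw [Finset.sum_sub_distrib, Finset.mul_sum]
        simp_rw [real_inner_smul_right]
        have h5 : ∑ t, σ ^ 2 / 2 * ‖l • k b (x t ω)‖ ^ 2 ≤ σ ^ 2 / 2 * (l * r) ^ 2 * T := by
          refine (Finset.sum_le_card_nsmul _ _ (σ ^ 2 / 2 * (l * r) ^ 2) fun t _ => ?_).trans
            (le_of_eq ?_)
          · have : ‖l • k b (x t ω)‖ ≤ l * r := by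
              rw [norm_smul, Real.norm_of_nonneg hl0.le]
              exact mul_le_mul_of_nonneg_left (hkr b hb _) hl0.le
            gcongr
          · simp [mul_comm]
        linarith
      refine (lintegral_mono h4).trans ?_
      rw [lintegral_const_mul' _ _ ENNReal.ofReal_ne_top]
      exact mul_le_of_le_one_right' (hnoise (fun u => l • k b u) ((hk b hb).const_smul l)))
  refine ⟨R, h1, h2, h3.trans (le_of_eq ?_)⟩
  have hH' : H = q ^ 2 / (2 * T) := by rw [hq2]; field_simp
  rw [hH', hl]
  field_simp
  ring

end NoiseMaxima

/-! ### Chaining and the localised error bound. -/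

section Chaining

variable {Ω X E : Type*} {mΩ : MeasurableSpace Ω} {P : Measure Ω} [IsProbabilityMeasure P]
  [MeasurableSpace X] [NormedAddCommGroup E] [InnerProductSpace ℝ E] [MeasurableSpace E]
  [BorelSpace E] [SecondCountableTopology E] {T : ℕ} {x : Fin T → Ω → X} {w : Fin T → Ω → E}
  {σ : ℝ}

/-- Chaining along dyadic nets: the process is controlled on increments between the `J`-th net and
the coarsest one. -/
theorem exists_chain_dominating (hx : ∀ t, Measurable (x t)) (hw : ∀ t, Measurable (w t))
    (hσ : 0 < σ) (hT : 0 < T)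
    (hnoise : ∀ k : X → E, Measurable k → ∫⁻ ω, ENNReal.ofReal (Real.exp
      (∑ t, (inner ℝ (w t ω) (k (x t ω)) - σ ^ 2 / 2 * ‖k (x t ω)‖ ^ 2))) ∂P ≤ 1)
    {F : Set (X → E)} (hF : ∀ f ∈ F, Measurable f) {γ : ℝ} (hγ : 0 < γ)
    (C : ℕ → Finset (X → E)) (H : ℕ → ℝ) (J : ℕ)
    (hCF : ∀ j ≤ J, ∀ f ∈ C j, f ∈ F)
    (hC : ∀ j ≤ J, ∀ f ∈ F, ∃ g ∈ C j, ∀ u, ‖f u - g u‖ ≤ γ / 2 ^ j)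
    (hH : ∀ j ≤ J, 0 < H j) (hcard : ∀ j ≤ J, ((C j).card : ℝ) ≤ Real.exp (H j)) :
    ∃ R : Ω → ℝ, Integrable R P ∧
      (∀ f ∈ C J, ∃ g ∈ C 0, (∀ u, ‖f u - g u‖ ≤ 2 * γ - 2 * (γ / 2 ^ J)) ∧
        ∀ ω, ∑ t, inner ℝ (w t ω) (f (x t ω) - g (x t ω)) ≤ R ω) ∧
      ∫ ω, R ω ∂P ≤ ∑ j ∈ Finset.range J, σ * (γ / 2 ^ j) * √(2 * H (j + 1) * T) := by
  induction J with
  | zero =>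
    refine ⟨fun _ => 0, integrable_zero _ _ _, fun f hf => ⟨f, hf, ?_, ?_⟩, by simp⟩ <;> simp
  | succ J ih =>
    obtain ⟨R₁, hR₁, hR₁', hR₁i⟩ := ih (fun j hj => hCF j (by omega)) (fun j hj => hC j (by omega))
      (fun j hj => hH j (by omega)) (fun j hj => hcard j (by omega))
    have hproj : ∀ f : X → E, ∃ g : X → E, f ∈ F → g ∈ C J ∧ ∀ u, ‖f u - g u‖ ≤ γ / 2 ^ J := by
      intro f
      by_cases hf : f ∈ F
      · obtain ⟨g, hg⟩ := hC J (Nat.le_succ J) f hf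
        exact ⟨g, fun _ => hg⟩
      · exact ⟨f, fun h => absurd h hf⟩
    choose p hp using hproj
    obtain ⟨R₂, hR₂, hR₂', hR₂i⟩ := exists_process_dominating (P := P) hx hw hσ hnoise (C (J + 1))
      (k := fun f u => f u - p f u) (r := γ / 2 ^ J) (H := H (J + 1))
      (fun f hf => by
        have hf' := hCF _ le_rfl f hf
        exact (hF f hf').sub (hF _ (hCF J (Nat.le_succ J) _ (hp f hf').1)))
      (by positivity) hT (fun f hf => (hp f (hCF _ le_rfl f hf)).2) (hH _ le_rfl) (hcard _ le_rfl)
    refine ⟨fun ω => R₁ ω + R₂ ω, hR₁.add hR₂, ?_, ?_⟩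
    · intro f hf
      obtain ⟨hpC, hpd⟩ := hp f (hCF _ le_rfl f hf)
      obtain ⟨g, hg, hgd, hgR⟩ := hR₁' (p f) hpC
      refine ⟨g, hg, fun u => ?_, fun ω => ?_⟩
      -- The radius `2γ - 2γ / 2^J` is the geometric sum of the link lengths `γ / 2^j`, `j < J`.
      · have h1 := norm_add_le (f u - p f u) (p f u - g u)
        rw [sub_add_sub_cancel] at h1
        have h2 := hgd u
        have h3 := hpd u
        have h4 : 2 * (γ / 2 ^ (J + 1)) = γ / 2 ^ J := by rw [pow_succ]; field_simp
        linarith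
      · have h1 := hgR ω
        have h2 := hR₂' f hf ω
        have h3 : ∑ t, inner ℝ (w t ω) (f (x t ω) - g (x t ω))
            = ∑ t, inner ℝ (w t ω) (p f (x t ω) - g (x t ω))
              + ∑ t, inner ℝ (w t ω) (f (x t ω) - p f (x t ω)) := by
          rw [← Finset.sum_add_distrib]
          refine Finset.sum_congr rfl fun t _ => ?_
          rw [← inner_add_right, add_comm, sub_add_sub_cancel]
        linarith
    · rw [integral_add hR₁ hR₂, Finset.sum_range_succ]
      exact add_le_add hR₁i hR₂i

/-- Any function satisfying the basic inequality of least squares has small empirical error. -/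
theorem exists_empirical_error_dominating (hx : ∀ t, Measurable (x t))
    (hw : ∀ t, Measurable (w t)) (hσ : 0 < σ) (hT : 0 < T)
    (hnoise : ∀ k : X → E, Measurable k → ∫⁻ ω, ENNReal.ofReal (Real.exp
      (∑ t, (inner ℝ (w t ω) (k (x t ω)) - σ ^ 2 / 2 * ‖k (x t ω)‖ ^ 2))) ∂P ≤ 1)
    (hw_int : ∀ t, Integrable (w t) P) {m : ℝ} (hm : ∀ t, ∫ ω, ‖w t ω‖ ∂P ≤ m)
    {F : Set (X → E)} (hF : ∀ f ∈ F, Measurable f) {fstar : X → E} (hfstar : fstar ∈ F)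
    {γ : ℝ} (hγ : 0 < γ)
    (C : ℕ → Finset (X → E)) (H : ℕ → ℝ) (J : ℕ)
    (hCF : ∀ j ≤ J, ∀ f ∈ C j, f ∈ F)
    (hC : ∀ j ≤ J, ∀ f ∈ F, ∃ g ∈ C j, ∀ u, ‖f u - g u‖ ≤ γ / 2 ^ j)
    (hH : ∀ j ≤ J, 0 < H j) (hcard : ∀ j ≤ J, ((C j).card : ℝ) ≤ Real.exp (H j)) :
    ∃ R : Ω → ℝ, Integrable R P ∧
      (∀ f ∈ F, ∀ ω, ∑ t, ‖f (x t ω) - fstar (x t ω)‖ ^ 2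
          ≤ 2 * ∑ t, inner ℝ (w t ω) (f (x t ω) - fstar (x t ω)) →
        ∑ t, ‖f (x t ω) - fstar (x t ω)‖ ^ 2 ≤ R ω) ∧
      ∫ ω, R ω ∂P ≤ 8 * σ ^ 2 * H 0 + 4 * γ * σ * √(8 * H 0 * T)
        + 4 * ∑ j ∈ Finset.range J, σ * (γ / 2 ^ j) * √(2 * H (j + 1) * T)
        + 4 * (γ / 2 ^ J) * (T * m) := by
  have hT' : (0 : ℝ) < T := by exact_mod_cast hT
  have hH0 := hH 0 (Nat.zero_le _)
  set q := √(8 * H 0 * T) with hq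
  have hq0 : 0 < q := by positivity
  have hq2 : q ^ 2 = 8 * H 0 * T := Real.sq_sqrt (by positivity)
  -- Passing from `g - fstar` to `f - fstar` uses `(a + b)² ≤ (1 + ε)(a² + b²/ε)` with `b = 2γ`; the
  -- offset weight `c` makes the coefficient of `a²` equal to `1/2`. The cost is `8σ²H₀(1 + ε) +
  -- T(2γ)²/ε`, and this `ε` minimises it, keeping the leading constant 8.
  set ε := 2 * γ * T / (σ * q) with hε
  have hε0 : 0 < ε := by positivity
  set c := 1 / (2 * (1 + ε)) with hc
  have hc0 : 0 < c := by positivity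
  obtain ⟨R₁, hR₁, hR₁', hR₁i⟩ := exists_chain_dominating (P := P) hx hw hσ hT hnoise hF hγ C H J
    hCF hC hH hcard
  obtain ⟨R₂, hR₂, hR₂', hR₂i⟩ := exists_offset_dominating (P := P) hx hw hσ hnoise (C 0)
    (k := fun g u => g u - fstar u)
    (fun g hg => (hF g (hCF 0 (Nat.zero_le _) g hg)).sub (hF _ hfstar)) hc0 (hcard 0 (Nat.zero_le _))
  have hN : Integrable (fun ω => ∑ t, ‖w t ω‖) P := integrable_finsetSum _ fun t _ => (hw_int t).norm
  -- Half of the left-hand side is absorbed by the offset term; solving for the rest doubles the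
  -- coefficients 2, 2, 1 of the three links.
  refine ⟨fun ω => 4 * (γ / 2 ^ J) * ∑ t, ‖w t ω‖ + 4 * R₁ ω + 2 * R₂ ω + T * (2 * γ) ^ 2 / ε,
    (((hN.const_mul _).add (hR₁.const_mul 4)).add (hR₂.const_mul 2)).add (integrable_const _),
    ?_, ?_⟩
  · intro f hf ω hbasic
    obtain ⟨h, hh, hfh⟩ := hC J le_rfl f hf
    obtain ⟨g, hg, hgd, hgR⟩ := hR₁' h hh
    have hfg : ∀ u, ‖f u - g u‖ ≤ 2 * γ := by
      intro u
      have h1 := norm_add_le (f u - h u) (h u - g u)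
      rw [sub_add_sub_cancel] at h1
      have h2 := hfh u
      have h3 := hgd u
      have h4 : 0 < γ / 2 ^ J := by positivity
      linarith
    have e1 : ∑ t, inner ℝ (w t ω) (f (x t ω) - h (x t ω)) ≤ γ / 2 ^ J * ∑ t, ‖w t ω‖ := by
      rw [Finset.mul_sum]
      refine Finset.sum_le_sum fun t _ => (real_inner_le_norm _ _).trans ?_
      rw [mul_comm]
      exact mul_le_mul_of_nonneg_right (hfh _) (norm_nonneg _)
    have e2 := hgR ω
    have e3 := hR₂' g hg ω
    have e4 : ∑ t, c * ‖g (x t ω) - fstar (x t ω)‖ ^ 2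
        ≤ ∑ t, (‖f (x t ω) - fstar (x t ω)‖ ^ 2 / 2 + (2 * γ) ^ 2 / ε / 2) := by
      refine Finset.sum_le_sum fun t _ => ?_
      set a := ‖f (x t ω) - fstar (x t ω)‖
      set b := 2 * γ
      have hb : 0 < b := by positivity
      have h1 : ‖g (x t ω) - fstar (x t ω)‖ ≤ a + b := by
        have h2 := norm_add_le (f (x t ω) - fstar (x t ω)) (g (x t ω) - f (x t ω))
        rw [norm_sub_rev (g (x t ω)), sub_add_sub_cancel'] at h2
        exact h2.trans (add_le_add le_rfl (hfg _))
      have h2 : ‖g (x t ω) - fstar (x t ω)‖ ^ 2 ≤ (a + b) ^ 2 := by gcongr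
      have h3 : (a + b) ^ 2 ≤ (1 + ε) * (a ^ 2 + b ^ 2 / ε) := by
        have : (1 + ε) * (a ^ 2 + b ^ 2 / ε) - (a + b) ^ 2 = (ε * a - b) ^ 2 / ε := by
          field_simp; ring
        have : 0 ≤ (ε * a - b) ^ 2 / ε := by positivity
        linarith
      calc c * ‖g (x t ω) - fstar (x t ω)‖ ^ 2 ≤ c * ((1 + ε) * (a ^ 2 + b ^ 2 / ε)) :=
            mul_le_mul_of_nonneg_left (h2.trans h3) hc0.le
        _ = a ^ 2 / 2 + b ^ 2 / ε / 2 := by rw [hc]; field_simp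
    rw [Finset.sum_add_distrib, ← Finset.sum_div, Finset.sum_const, Finset.card_univ,
      Fintype.card_fin, nsmul_eq_mul] at e4
    rw [Finset.sum_sub_distrib, ← Finset.mul_sum] at e3
    have e5 : ∑ t, inner ℝ (w t ω) (f (x t ω) - fstar (x t ω))
        = ∑ t, inner ℝ (w t ω) (f (x t ω) - h (x t ω)) + ∑ t, inner ℝ (w t ω) (h (x t ω) - g (x t ω))
          + ∑ t, inner ℝ (w t ω) (g (x t ω) - fstar (x t ω)) := by
      rw [← Finset.sum_add_distrib, ← Finset.sum_add_distrib]
      refine Finset.sum_congr rfl fun t _ => ?_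
      rw [← inner_add_right, ← inner_add_right, sub_add_sub_cancel, sub_add_sub_cancel]
    have e6 : T * (2 * γ) ^ 2 / ε = 2 * (T * ((2 * γ) ^ 2 / ε / 2)) := by ring
    rw [e6]
    linarith
  · have i1 : Integrable (fun ω => 4 * (γ / 2 ^ J) * ∑ t, ‖w t ω‖) P := hN.const_mul _
    have i2 : Integrable (fun ω => 4 * R₁ ω) P := hR₁.const_mul 4
    have i3 : Integrable (fun ω => 2 * R₂ ω) P := hR₂.const_mul 2
    have i12 : Integrable (fun ω => 4 * (γ / 2 ^ J) * ∑ t, ‖w t ω‖ + 4 * R₁ ω) P := i1.add i2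
    have i123 : Integrable (fun ω => 4 * (γ / 2 ^ J) * ∑ t, ‖w t ω‖ + 4 * R₁ ω + 2 * R₂ ω) P :=
      i12.add i3
    rw [integral_add i123 (integrable_const _), integral_add i12 i3, integral_add i1 i2,
      integral_const_mul, integral_const_mul, integral_const_mul, integral_const,
      integral_finsetSum _ fun t _ => (hw_int t).norm]
    have h1 : ∑ t, ∫ ω, ‖w t ω‖ ∂P ≤ T * m := by
      refine (Finset.sum_le_sum fun t _ => hm t).trans (le_of_eq ?_)
      simp
    have h2 := mul_le_mul_of_nonneg_left h1 (show 0 ≤ 4 * (γ / 2 ^ J) by positivity)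
    have h3 : P.real Set.univ • (T * (2 * γ) ^ 2 / ε) = T * (2 * γ) ^ 2 / ε := by simp
    have h4 : 2 * (2 * σ ^ 2 * H 0 / c) + T * (2 * γ) ^ 2 / ε
        = 8 * σ ^ 2 * H 0 + 4 * γ * σ * q := by
      have hHq : H 0 = q ^ 2 / (8 * T) := by rw [hq2]; field_simp
      rw [hc, hε, hHq]
      field_simp
      ring
    rw [h3]
    linarith

end Chaining

/-! ### The basic inequality of least squares and moment comparisons. -/

theorem IsLSE.basic_inequality {T : ℕ} (hT : 0 < T) {X E : Type*} [NormedAddCommGroup E]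
    [InnerProductSpace ℝ E] {F : Set (X → E)} {xs : Fin T → X} {ys ws : Fin T → E}
    {f fstar : X → E} (hf : IsLSE F xs ys f) (hfstar : fstar ∈ F)
    (hy : ∀ t, ys t = fstar (xs t) + ws t) :
    ∑ t, ‖f (xs t) - fstar (xs t)‖ ^ 2 ≤ 2 * ∑ t, inner ℝ (ws t) (f (xs t) - fstar (xs t)) := by
  have h := isMinOn_iff.1 hf.2 fstar hfstar
  have hT' : (0 : ℝ) < 1 / T := by positivity
  have h1 := le_of_mul_le_mul_left h hT'
  have h2 : ∀ t, ‖ys t - f (xs t)‖ ^ 2 = ‖ys t - fstar (xs t)‖ ^ 2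
      - 2 * inner ℝ (ws t) (f (xs t) - fstar (xs t)) + ‖f (xs t) - fstar (xs t)‖ ^ 2 := by
    intro t
    have e1 : ys t - f (xs t) = ws t - (f (xs t) - fstar (xs t)) := by rw [hy]; abel
    have e2 : ys t - fstar (xs t) = ws t := by rw [hy]; abel
    rw [e1, e2, norm_sub_sq_real]
  simp_rw [h2] at h1
  rw [Finset.sum_add_distrib, Finset.sum_sub_distrib, ← Finset.mul_sum] at h1
  linarith

/-- An entropy-free a priori bound from Young's inequality; it serves when the noise vanishes or the
entropy exceeds `d T`. -/
theorem sum_sq_le_of_basic_inequality {T : ℕ} {E : Type*} [NormedAddCommGroup E]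
    [InnerProductSpace ℝ E] {h w : Fin T → E}
    (hb : ∑ t, ‖h t‖ ^ 2 ≤ 2 * ∑ t, inner ℝ (w t) (h t)) :
    ∑ t, ‖h t‖ ^ 2 ≤ 4 * ∑ t, ‖w t‖ ^ 2 := by
  have h1 : ∑ t, inner ℝ (w t) (h t) ≤ ∑ t, (‖w t‖ ^ 2 + ‖h t‖ ^ 2 / 4) := by
    refine Finset.sum_le_sum fun t _ => (real_inner_le_norm _ _).trans ?_
    nlinarith [sq_nonneg (‖w t‖ - ‖h t‖ / 2)]
  rw [Finset.sum_add_distrib, ← Finset.sum_div] at h1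
  linarith

theorem lintegral_le_sqrt_lintegral_sq {Ω : Type*} {mΩ : MeasurableSpace Ω} {P : Measure Ω}
    [IsProbabilityMeasure P] {f : Ω → ℝ≥0∞} (hf : AEMeasurable f P) :
    ∫⁻ ω, f ω ∂P ≤ (∫⁻ ω, f ω ^ 2 ∂P) ^ (1 / 2 : ℝ) := by
  have h := ENNReal.lintegral_mul_le_Lp_mul_Lq P Real.HolderConjugate.two_two hf
    (aemeasurable_const (b := (1 : ℝ≥0∞)))
  simpa using h

theorem integral_norm_le_of_lintegral_sq_le {Ω E : Type*} {mΩ : MeasurableSpace Ω} {P : Measure Ω}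
    [IsProbabilityMeasure P] [NormedAddCommGroup E] {W : Ω → E} (hW : AEStronglyMeasurable W P)
    {b : ℝ} (h : ∫⁻ ω, ENNReal.ofReal (‖W ω‖ ^ 2) ∂P ≤ ENNReal.ofReal b) :
    ∫ ω, ‖W ω‖ ∂P ≤ √b := by
  rw [integral_eq_lintegral_of_nonneg_ae (.of_forall fun ω => norm_nonneg _) hW.norm]
  refine ENNReal.toReal_le_of_le_ofReal (Real.sqrt_nonneg _) ?_
  refine (lintegral_le_sqrt_lintegral_sq hW.norm.aemeasurable.ennreal_ofReal).trans ?_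
  have e : ∀ ω, ENNReal.ofReal ‖W ω‖ ^ 2 = ENNReal.ofReal (‖W ω‖ ^ 2) := fun ω =>
    (ENNReal.ofReal_pow (norm_nonneg _) 2).symm
  simp_rw [e]
  refine (ENNReal.rpow_le_rpow h (by norm_num)).trans ?_
  rcases le_total 0 b with hb | hb
  · rw [ENNReal.ofReal_rpow_of_nonneg hb (by norm_num), Real.sqrt_eq_rpow]
  · rw [ENNReal.ofReal_of_nonpos hb, ENNReal.zero_rpow_of_pos (by norm_num)]
    exact zero_le

/-! ### Nets, the entropy integral and constants. -/

theorem metricEntropy_anti {X E : Type*} [PseudoEMetricSpace E] (F : Set (X → E)) :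
    Antitone (metricEntropy F) := by
  intro s s' h
  exact EReal.toENNReal_le_toENNReal (ENNReal.log_monotone
    (by exact_mod_cast Metric.coveringNumber_anti h))

theorem exists_finset_cover_of_metricEntropy_ne_top {X E : Type*} [NormedAddCommGroup E]
    {F : Set (X → E)} (hF : F.Nonempty) {s : ℝ≥0} (hs : metricEntropy F s ≠ ⊤) :
    ∃ C : Finset (X → E), (∀ f ∈ C, f ∈ F) ∧ (∀ f ∈ F, ∃ g ∈ C, ∀ u, ‖f u - g u‖ ≤ s) ∧
      (C.card : ℝ) ≤ Real.exp (metricEntropy F s).toReal := by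
  classical
  set A : Set (UniformFun X E) := UniformFun.ofFun '' F with hA
  have hcov : Metric.coveringNumber s A ≠ ⊤ := by
    intro h
    apply hs
    simp [metricEntropy, ← hA, h]
  obtain ⟨C', hC'A, hfin, hcover, hcard⟩ := Metric.exists_set_encard_eq_coveringNumber hcov
  -- A nonempty class has covering number at least one, so the logarithm is nonnegative and
  -- `toENNReal` in `metricEntropy` loses nothing.
  have hpos : 0 < Metric.coveringNumber s A := Metric.coveringNumber_pos_iff.2 (hF.image _)
  have hcard' : (hfin.toFinset.image UniformFun.toFun).card = hfin.toFinset.card :=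
    Finset.card_image_of_injective _ UniformFun.toFun.injective
  have hN : Metric.coveringNumber s A = (hfin.toFinset.card : ℕ∞) := by
    rw [← hcard, hfin.encard_eq_coe_toFinset_card]
  have hN0 : 0 < hfin.toFinset.card := by
    rw [hN] at hpos
    exact_mod_cast hpos
  have hlog : Real.log hfin.toFinset.card = (metricEntropy F s).toReal := by
    rw [metricEntropy, ← hA, hN]
    have h1 : (((hfin.toFinset.card : ℕ∞) : ℝ≥0∞)) = ENNReal.ofReal hfin.toFinset.card := by
      simp
    rw [h1, ENNReal.log_ofReal_of_pos (by exact_mod_cast hN0)]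
    rw [EReal.toENNReal_of_ne_top (EReal.coe_ne_top _), EReal.toReal_coe, ENNReal.toReal_ofReal]
    exact Real.log_nonneg (by exact_mod_cast hN0)
  refine ⟨hfin.toFinset.image UniformFun.toFun, ?_, ?_, ?_⟩
  · intro f hf
    obtain ⟨g, hg, rfl⟩ := Finset.mem_image.1 hf
    obtain ⟨f', hf', rfl⟩ := hC'A (hfin.mem_toFinset.1 hg)
    exact hf'
  · intro f hf
    obtain ⟨g, hg, hfg⟩ := hcover (Set.mem_image_of_mem _ hf)
    refine ⟨UniformFun.toFun g, Finset.mem_image_of_mem _ (hfin.mem_toFinset.2 hg), fun u => ?_⟩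
    have h1 := UniformFun.edist_le.1 hfg u
    rw [edist_eq_enorm_sub] at h1
    have h2 : ‖f u - UniformFun.toFun g u‖₊ ≤ s := by exact_mod_cast h1
    exact_mod_cast h2
  · rw [hcard', ← hlog, Real.exp_log (by exact_mod_cast hN0)]

/-- A dyadic sum is controlled by the entropy integral. -/
theorem sum_dyadic_le_lintegral {φ : ℝ → ℝ≥0∞} (hφ : Antitone φ) {γ : ℝ} (hγ : 0 ≤ γ) (J : ℕ) :
    ∑ j ∈ Finset.range (J + 1), ENNReal.ofReal (γ / 2 ^ j) * φ (γ / 2 ^ j)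
      ≤ 2 * ∫⁻ s in Set.Ioc (γ / 2 ^ (J + 1)) γ, φ s := by
  -- The interval has length half of `γ / 2^j`, and `φ` is smallest at its right end; hence the
  -- factor 2.
  have hstep : ∀ j : ℕ, ENNReal.ofReal (γ / 2 ^ j) * φ (γ / 2 ^ j)
      ≤ 2 * ∫⁻ s in Set.Ioc (γ / 2 ^ (j + 1)) (γ / 2 ^ j), φ s := by
    intro j
    have h1 : ∫⁻ _ in Set.Ioc (γ / 2 ^ (j + 1)) (γ / 2 ^ j), φ (γ / 2 ^ j)
        ≤ ∫⁻ s in Set.Ioc (γ / 2 ^ (j + 1)) (γ / 2 ^ j), φ s :=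
      setLIntegral_mono' measurableSet_Ioc fun s hs => hφ hs.2
    rw [setLIntegral_const, Real.volume_Ioc] at h1
    refine le_trans (le_of_eq ?_) (mul_le_mul_right h1 2)
    rw [mul_comm (φ _), ← mul_assoc, show (2 : ℝ≥0∞) = ENNReal.ofReal 2 by simp,
      ← ENNReal.ofReal_mul (by norm_num)]
    congr 2
    rw [pow_succ]
    field_simp
    norm_num
  induction J with
  | zero => simpa using hstep 0
  | succ J ih =>
    have h1 : γ / 2 ^ (J + 1 + 1) ≤ γ / 2 ^ (J + 1) := by
      gcongr <;> norm_num
    have h2 : γ / 2 ^ (J + 1) ≤ γ := div_le_self hγ (one_le_pow₀ (by norm_num))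
    rw [Finset.sum_range_succ, ← Set.Ioc_union_Ioc_eq_Ioc h1 h2,
      lintegral_union measurableSet_Ioc (Set.Ioc_disjoint_Ioc_of_le le_rfl), mul_add, add_comm]
    exact add_le_add (hstep (J + 1)) ih

/-- After the index shift, the balancing term `4γσ√(8ℓ₀T)` is exactly the missing `j = 0` term of
the chaining sum. The constants come from `8√2 ≤ 12` and `4√2 ≤ 6`. -/
theorem dyadic_error_bound_le {T : ℝ} (hT' : 0 < T) {σ γ d : ℝ} (hσ : 0 < σ) (hγ : 0 < γ)
    {ℓ : ℕ → ℝ} (hℓ0 : ∀ j, 0 ≤ ℓ j) (J : ℕ) :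
    (1 / T) * (8 * σ ^ 2 * ℓ 0 + 4 * γ * σ * √(8 * ℓ 0 * T)
        + 4 * ∑ j ∈ Finset.range J, σ * (γ / 2 ^ j) * √(2 * ℓ (j + 1) * T)
        + 4 * (γ / 2 ^ J) * (T * √(2 * σ ^ 2 * d)))
      ≤ 8 * σ ^ 2 * ℓ 0 / T + 12 * (σ / √T) * ∑ j ∈ Finset.range (J + 1), γ / 2 ^ j * √(ℓ j)
        + 6 * (γ / 2 ^ J) * σ * √d := by
  set τ := √T with hτ
  have hτ0 : 0 < τ := Real.sqrt_pos.2 hT'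
  have hτ2 : T = τ ^ 2 := (Real.sq_sqrt hT'.le).symm
  set r := √(2 : ℝ) with hr
  have hr0 : 0 ≤ r := Real.sqrt_nonneg _
  have hr2 : r ≤ 3 / 2 := Real.sqrt_le_iff.2 ⟨by norm_num, by norm_num⟩
  have e1 : √(8 * ℓ 0 * T) = 2 * r * √(ℓ 0) * τ := by
    rw [Real.sqrt_mul (by have := hℓ0 0; positivity), Real.sqrt_mul (by norm_num),
      show (8 : ℝ) = 2 ^ 2 * 2 by norm_num, Real.sqrt_mul (by norm_num),
      Real.sqrt_sq (by norm_num)]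
  have e2 : ∀ j, √(2 * ℓ (j + 1) * T) = r * √(ℓ (j + 1)) * τ := by
    intro j
    rw [Real.sqrt_mul (by have := hℓ0 (j + 1); positivity), Real.sqrt_mul (by norm_num)]
  have e3 : √(2 * σ ^ 2 * d) = r * σ * √d := by
    rw [Real.sqrt_mul (by positivity), Real.sqrt_mul (by norm_num), Real.sqrt_sq hσ.le]
  have e4 : 4 * γ * σ * √(8 * ℓ 0 * T)
      + 4 * ∑ j ∈ Finset.range J, σ * (γ / 2 ^ j) * √(2 * ℓ (j + 1) * T)
      = 8 * r * σ * τ * ∑ j ∈ Finset.range (J + 1), γ / 2 ^ j * √(ℓ j) := by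
    rw [Finset.sum_range_succ', mul_add, Finset.mul_sum, Finset.mul_sum, e1, add_comm]
    congr 1
    · refine Finset.sum_congr rfl fun j _ => ?_
      rw [e2, pow_succ]
      field_simp
      ring
    · simp only [pow_zero, div_one]
      ring
  have hS : 0 ≤ ∑ j ∈ Finset.range (J + 1), γ / 2 ^ j * √(ℓ j) :=
    Finset.sum_nonneg fun j _ => by positivity
  rw [add_assoc (8 * σ ^ 2 * ℓ 0), e4, e3]
  set S := ∑ j ∈ Finset.range (J + 1), γ / 2 ^ j * √(ℓ j) with hSdef
  have e6 : (1 / T) * (8 * σ ^ 2 * ℓ 0 + 8 * r * σ * τ * S + 4 * (γ / 2 ^ J) * (T * (r * σ * √d)))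
      = 8 * σ ^ 2 * ℓ 0 / T + 8 * r * (σ / τ * S) + 4 * r * ((γ / 2 ^ J) * σ * √d) := by
    rw [hτ2]
    field_simp
  have h1 : 8 * r * (σ / τ * S) ≤ 12 * (σ / τ * S) := by
    have : 0 ≤ σ / τ * S := by positivity
    nlinarith
  have h2 : 4 * r * ((γ / 2 ^ J) * σ * √d) ≤ 6 * ((γ / 2 ^ J) * σ * √d) := by
    have : 0 ≤ (γ / 2 ^ J : ℝ) * σ * √d := by positivity
    nlinarith
  rw [e6]
  linarith

/-! ### The expected empirical error. -/

theorem lintegral_empirical_error_le_of_second_moment {Ω X : Type*} {mΩ : MeasurableSpace Ω}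
    {P : Measure Ω} {T d : ℕ} {x : Fin T → Ω → X} {w : Fin T → Ω → EuclideanSpace ℝ (Fin d)}
    {F : Set (X → EuclideanSpace ℝ (Fin d))} {fstar : X → EuclideanSpace ℝ (Fin d)}
    {fhat : Ω → X → EuclideanSpace ℝ (Fin d)} (hT : 0 < T) (hw : ∀ t, Measurable (w t))
    {b : ℝ}
    (hw2 : ∀ t, ∫⁻ ω, ENNReal.ofReal (‖w t ω‖ ^ 2) ∂P ≤ ENNReal.ofReal b)
    (hbasic : ∀ᵐ ω ∂P, fhat ω ∈ F ∧ ∑ t, ‖fhat ω (x t ω) - fstar (x t ω)‖ ^ 2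
      ≤ 2 * ∑ t, inner ℝ (w t ω) (fhat ω (x t ω) - fstar (x t ω))) :
    ∫⁻ ω, ENNReal.ofReal ((1 / T) * ∑ t, ‖fhat ω (x t ω) - fstar (x t ω)‖ ^ 2) ∂P
      ≤ ENNReal.ofReal (4 * b) := by
  have hT' : (0 : ℝ) < T := by exact_mod_cast hT
  have h1 : ∀ᵐ ω ∂P, ENNReal.ofReal ((1 / T) * ∑ t, ‖fhat ω (x t ω) - fstar (x t ω)‖ ^ 2)
      ≤ ENNReal.ofReal (4 / T) * ∑ t, ENNReal.ofReal (‖w t ω‖ ^ 2) := by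
    filter_upwards [hbasic] with ω hω
    rw [← ENNReal.ofReal_sum_of_nonneg fun t _ => sq_nonneg _, ← ENNReal.ofReal_mul (by positivity)]
    refine ENNReal.ofReal_le_ofReal ?_
    have h2 := mul_le_mul_of_nonneg_left (sum_sq_le_of_basic_inequality hω.2)
      (show (0 : ℝ) ≤ 1 / T by positivity)
    refine h2.trans (le_of_eq ?_)
    ring
  refine (lintegral_mono_ae h1).trans ?_
  rw [lintegral_const_mul' _ _ ENNReal.ofReal_ne_top, lintegral_finsetSum _ fun t _ => by fun_prop]
  refine (mul_le_mul_right (Finset.sum_le_sum fun t _ => hw2 t) _).trans (le_of_eq ?_)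
  rw [Finset.sum_const, Finset.card_univ, Fintype.card_fin, ← ENNReal.ofReal_nsmul,
    ← ENNReal.ofReal_mul (by positivity), nsmul_eq_mul]
  congr 1
  field_simp

section EmpiricalError

variable {Ω X : Type*} {mΩ : MeasurableSpace Ω} {P : Measure Ω} [IsProbabilityMeasure P]
  [MeasurableSpace X] {T d : ℕ} {x : Fin T → Ω → X} {w : Fin T → Ω → EuclideanSpace ℝ (Fin d)}
  {F : Set (X → EuclideanSpace ℝ (Fin d))} {fstar : X → EuclideanSpace ℝ (Fin d)}
  {fhat : Ω → X → EuclideanSpace ℝ (Fin d)}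

theorem lintegral_empirical_error_le_dyadic (hx : ∀ t, Measurable (x t))
    (hw : ∀ t, Measurable (w t)) {σ : ℝ} (hσ : 0 < σ) (hT : 0 < T)
    (hnoise : ∀ k : X → EuclideanSpace ℝ (Fin d), Measurable k → ∫⁻ ω, ENNReal.ofReal (Real.exp
      (∑ t, (inner ℝ (w t ω) (k (x t ω)) - σ ^ 2 / 2 * ‖k (x t ω)‖ ^ 2))) ∂P ≤ 1)
    (hw_int : ∀ t, Integrable (w t) P)
    (hw2 : ∀ t, ∫⁻ ω, ENNReal.ofReal (‖w t ω‖ ^ 2) ∂P ≤ ENNReal.ofReal (2 * σ ^ 2 * d))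
    (hF : ∀ f ∈ F, Measurable f) (hfstar : fstar ∈ F)
    (hbasic : ∀ᵐ ω ∂P, fhat ω ∈ F ∧ ∑ t, ‖fhat ω (x t ω) - fstar (x t ω)‖ ^ 2
      ≤ 2 * ∑ t, inner ℝ (w t ω) (fhat ω (x t ω) - fstar (x t ω)))
    {γ : ℝ≥0} (hγ : 0 < γ) (J : ℕ) (hent : ∀ j ≤ J, metricEntropy F (γ / 2 ^ j) ≠ ⊤) :
    ∫⁻ ω, ENNReal.ofReal ((1 / T) * ∑ t, ‖fhat ω (x t ω) - fstar (x t ω)‖ ^ 2) ∂P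
      ≤ ENNReal.ofReal (8 * σ ^ 2 * (metricEntropy F γ).toReal / T
        + 12 * (σ / √T) * ∑ j ∈ Finset.range (J + 1),
            γ / 2 ^ j * √(metricEntropy F (γ / 2 ^ j)).toReal
        + 6 * (γ / 2 ^ J) * σ * √d) := by
  have hT' : (0 : ℝ) < T := by exact_mod_cast hT
  have hγ' : (0 : ℝ) < γ := by exact_mod_cast hγ
  set ℓ : ℕ → ℝ := fun j => (metricEntropy F (γ / 2 ^ j)).toReal with hℓ
  have hℓ0 : ∀ j, 0 ≤ ℓ j := fun j => ENNReal.toReal_nonneg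
  have hnet : ∀ j, ∃ C : Finset (X → EuclideanSpace ℝ (Fin d)), j ≤ J → (∀ f ∈ C, f ∈ F) ∧
      (∀ f ∈ F, ∃ g ∈ C, ∀ u, ‖f u - g u‖ ≤ (γ : ℝ) / 2 ^ j) ∧ (C.card : ℝ) ≤ Real.exp (ℓ j) := by
    intro j
    by_cases hj : j ≤ J
    · obtain ⟨C, h1, h2, h3⟩ :=
        exists_finset_cover_of_metricEntropy_ne_top ⟨fstar, hfstar⟩ (hent j hj)
      exact ⟨C, fun _ => ⟨h1, by simpa using h2, h3⟩⟩
    · exact ⟨∅, fun h => absurd h hj⟩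
  choose C hC using hnet
  -- The entropy may be zero, while the maximal inequalities need `H > 0`; it is raised by `θ`, and
  -- `θ → 0` by continuity.
  have hmain : ∀ θ : ℝ, 0 < θ →
      ∫⁻ ω, ENNReal.ofReal ((1 / T) * ∑ t, ‖fhat ω (x t ω) - fstar (x t ω)‖ ^ 2) ∂P
      ≤ ENNReal.ofReal ((1 / T) * (8 * σ ^ 2 * (ℓ 0 + θ) + 4 * γ * σ * √(8 * (ℓ 0 + θ) * T)
        + 4 * ∑ j ∈ Finset.range J, σ * (γ / 2 ^ j) * √(2 * (ℓ (j + 1) + θ) * T)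
        + 4 * (γ / 2 ^ J) * (T * √(2 * σ ^ 2 * d)))) := by
    intro θ hθ
    obtain ⟨R, hR, hR1, hR2⟩ := exists_empirical_error_dominating (P := P) hx hw hσ hT hnoise hw_int
      (fun t => integral_norm_le_of_lintegral_sq_le (hw t).aestronglyMeasurable (hw2 t)) hF hfstar
      hγ' C (fun j => ℓ j + θ) J (fun j hj => (hC j hj).1) (fun j hj => (hC j hj).2.1)
      (fun j _ => by have := hℓ0 j; positivity)
      (fun j hj => (hC j hj).2.2.trans (Real.exp_le_exp.2 (by linarith)))
    have hle : ∀ᵐ ω ∂P, ∑ t, ‖fhat ω (x t ω) - fstar (x t ω)‖ ^ 2 ≤ R ω := by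
      filter_upwards [hbasic] with ω hω using hR1 _ hω.1 ω hω.2
    have hR0 : 0 ≤ᵐ[P] fun ω => (1 / T) * R ω := by
      filter_upwards [hle] with ω hω
      have : 0 ≤ R ω := le_trans (by positivity) hω
      show 0 ≤ (1 / T) * R ω
      positivity
    calc _ ≤ ∫⁻ ω, ENNReal.ofReal ((1 / T) * R ω) ∂P := by
          refine lintegral_mono_ae ?_
          filter_upwards [hle] with ω hω
          gcongr
      _ = ENNReal.ofReal (∫ ω, (1 / T) * R ω ∂P) :=
          (ofReal_integral_eq_lintegral_ofReal (hR.const_mul _) hR0).symm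
      _ ≤ _ := by
          rw [integral_const_mul]
          gcongr
  have hlim : Filter.Tendsto (fun θ : ℝ => ENNReal.ofReal ((1 / T) *
      (8 * σ ^ 2 * (ℓ 0 + θ) + 4 * γ * σ * √(8 * (ℓ 0 + θ) * T)
        + 4 * ∑ j ∈ Finset.range J, σ * (γ / 2 ^ j) * √(2 * (ℓ (j + 1) + θ) * T)
        + 4 * (γ / 2 ^ J) * (T * √(2 * σ ^ 2 * d))))) (nhdsWithin 0 (Set.Ioi 0))
      (nhds (ENNReal.ofReal ((1 / T) *
      (8 * σ ^ 2 * (ℓ 0 + 0) + 4 * γ * σ * √(8 * (ℓ 0 + 0) * T)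
        + 4 * ∑ j ∈ Finset.range J, σ * (γ / 2 ^ j) * √(2 * (ℓ (j + 1) + 0) * T)
        + 4 * (γ / 2 ^ J) * (T * √(2 * σ ^ 2 * d)))))) := by
    refine ENNReal.tendsto_ofReal (Filter.Tendsto.mono_left (Continuous.tendsto ?_ 0)
      nhdsWithin_le_nhds)
    fun_prop
  refine (ge_of_tendsto hlim (Filter.eventually_of_mem self_mem_nhdsWithin hmain)).trans ?_
  refine ENNReal.ofReal_le_ofReal ?_
  simp only [add_zero]
  have hℓγ : ℓ 0 = (metricEntropy F γ).toReal := by simp [hℓ]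
  rw [← hℓγ]
  exact dyadic_error_bound_le hT' hσ hγ' hℓ0 J

end EmpiricalError

theorem ofReal_sqrt_toReal {a : ℝ≥0∞} (ha : a ≠ ⊤) :
    ENNReal.ofReal √a.toReal = a ^ (1 / 2 : ℝ) := by
  rw [Real.sqrt_eq_rpow, ← ENNReal.ofReal_rpow_of_nonneg ENNReal.toReal_nonneg (by norm_num),
    ENNReal.ofReal_toReal ha]

theorem ofReal_sqrt_natCast (n : ℕ) : ENNReal.ofReal √(n : ℝ) = (n : ℝ≥0∞) ^ (1 / 2 : ℝ) := by
  rw [← ofReal_sqrt_toReal (ENNReal.natCast_ne_top n), ENNReal.toReal_natCast]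

section EmpiricalErrorENNReal

variable {Ω X : Type*} {mΩ : MeasurableSpace Ω} {P : Measure Ω} [IsProbabilityMeasure P]
  [MeasurableSpace X] {T d : ℕ} {x : Fin T → Ω → X} {w : Fin T → Ω → EuclideanSpace ℝ (Fin d)}
  {F : Set (X → EuclideanSpace ℝ (Fin d))} {fstar : X → EuclideanSpace ℝ (Fin d)}
  {fhat : Ω → X → EuclideanSpace ℝ (Fin d)}

/-- The empirical error of least squares, in terms of the entropy integral. -/
theorem lintegral_empirical_error_le (hx : ∀ t, Measurable (x t))
    (hw : ∀ t, Measurable (w t)) {σ : ℝ≥0} (hT : 0 < T)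
    (hnoise : ∀ k : X → EuclideanSpace ℝ (Fin d), Measurable k → ∫⁻ ω, ENNReal.ofReal (Real.exp
      (∑ t, (inner ℝ (w t ω) (k (x t ω)) - (σ : ℝ) ^ 2 / 2 * ‖k (x t ω)‖ ^ 2))) ∂P ≤ 1)
    (hw_int : ∀ t, Integrable (w t) P)
    (hw2 : ∀ t, ∫⁻ ω, ENNReal.ofReal (‖w t ω‖ ^ 2) ∂P ≤ ENNReal.ofReal (2 * (σ : ℝ) ^ 2 * d))
    (hF : ∀ f ∈ F, Measurable f) (hfstar : fstar ∈ F)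
    (hbasic : ∀ᵐ ω ∂P, fhat ω ∈ F ∧ ∑ t, ‖fhat ω (x t ω) - fstar (x t ω)‖ ^ 2
      ≤ 2 * ∑ t, inner ℝ (w t ω) (fhat ω (x t ω) - fstar (x t ω)))
    {γ α : ℝ≥0} (hγ : 0 < γ) (hαγ : α ≤ γ) :
    ∫⁻ ω, ENNReal.ofReal ((1 / T) * ∑ t, ‖fhat ω (x t ω) - fstar (x t ω)‖ ^ 2) ∂P
      ≤ 8 * (σ : ℝ≥0∞) ^ 2 * metricEntropy F γ / (T : ℝ≥0∞)
        + 128 * (α : ℝ≥0∞) * (σ : ℝ≥0∞) * (d : ℝ≥0∞) ^ (1 / 2 : ℝ)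
        + 64 * ((σ : ℝ≥0∞) / (T : ℝ≥0∞) ^ (1 / 2 : ℝ))
          * ∫⁻ s in Set.Ioc (α : ℝ) (γ : ℝ), metricEntropy F s.toNNReal ^ (1 / 2 : ℝ) := by
  have hT' : (0 : ℝ) < T := by exact_mod_cast hT
  have hγ' : (0 : ℝ) < γ := by exact_mod_cast hγ
  set A := ∫⁻ ω, ENNReal.ofReal ((1 / T) * ∑ t, ‖fhat ω (x t ω) - fstar (x t ω)‖ ^ 2) ∂P with hA
  have hcrude : A ≤ ENNReal.ofReal (4 * (2 * (σ : ℝ) ^ 2 * d)) :=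
    lintegral_empirical_error_le_of_second_moment hT hw hw2 hbasic
  rcases eq_or_ne σ 0 with rfl | hσ0
  · refine hcrude.trans ?_
    simp
  have hσ : (0 : ℝ) < σ := by exact_mod_cast pos_iff_ne_zero.2 hσ0
  have hσe : (σ : ℝ≥0∞) ≠ 0 := by exact_mod_cast hσ0
  have hTr : (T : ℝ≥0∞) ^ (1 / 2 : ℝ) ≠ ⊤ :=
    ENNReal.rpow_ne_top_of_nonneg (by norm_num) (ENNReal.natCast_ne_top T)
  set I := ∫⁻ s in Set.Ioc (α : ℝ) (γ : ℝ), metricEntropy F s.toNNReal ^ (1 / 2 : ℝ) with hI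
  by_cases hL : metricEntropy F γ = ⊤
  · rw [hL, ENNReal.mul_top (by simp [hσ0]), ENNReal.top_div_of_ne_top (ENNReal.natCast_ne_top T),
      top_add, top_add]
    exact le_top
  by_cases hItop : I = ⊤
  · rw [hItop, ENNReal.mul_top, add_top]
    · exact le_top
    · exact mul_ne_zero (by norm_num) (ENNReal.div_ne_zero.2 ⟨hσe, hTr⟩)
  set ℓ := (metricEntropy F γ).toReal with hℓ
  have hℓ0 : 0 ≤ ℓ := ENNReal.toReal_nonneg
  have hterm1 : 8 * (σ : ℝ≥0∞) ^ 2 * metricEntropy F γ / (T : ℝ≥0∞)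
      = ENNReal.ofReal (8 * (σ : ℝ) ^ 2 * ℓ / T) := by
    rw [ENNReal.ofReal_div_of_pos hT', ENNReal.ofReal_mul (by positivity),
      ENNReal.ofReal_mul (by norm_num), hℓ, ENNReal.ofReal_toReal hL, ENNReal.ofReal_natCast,
      ENNReal.ofReal_pow hσ.le, ENNReal.ofReal_coe_nnreal]
    norm_num
  have hterm3 : ∀ c r : ℝ≥0, (c : ℝ≥0∞) * r * σ * (d : ℝ≥0∞) ^ (1 / 2 : ℝ)
      = ENNReal.ofReal ((c : ℝ) * r * σ * √d) := by
    intro c r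
    rw [ENNReal.ofReal_mul (by positivity), ENNReal.ofReal_mul (by positivity),
      ENNReal.ofReal_mul (by positivity), ofReal_sqrt_natCast]
    simp only [ENNReal.ofReal_coe_nnreal]
  set φ : ℝ → ℝ≥0∞ := fun s => metricEntropy F s.toNNReal ^ (1 / 2 : ℝ) with hφ
  have hφ_anti : Antitone φ := fun s s' h => ENNReal.rpow_le_rpow
    (metricEntropy_anti F (Real.toNNReal_le_toNNReal h)) (by norm_num)
  have hφγ : ∀ j : ℕ, φ ((γ : ℝ) / 2 ^ j) = metricEntropy F (γ / 2 ^ j) ^ (1 / 2 : ℝ) := by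
    intro j
    have : ((γ : ℝ) / 2 ^ j).toNNReal = γ / 2 ^ j := by
      rw [show (γ : ℝ) / 2 ^ j = ((γ / 2 ^ j : ℝ≥0) : ℝ) by push_cast; rfl, Real.toNNReal_coe]
    rw [hφ]
    simp only [this]
  -- For `α > γ/2` the integral is too short to pay for even one dyadic scale. If `ℓ ≤ d T`, the
  -- single-scale bound is at most `18 γ σ √d ≤ 36 α σ √d` beyond the leading term; otherwise the
  -- crude bound `8σ²d` is already below `8σ²ℓ/T`.
  by_cases hα : (γ : ℝ) / 2 < α
  · by_cases hd : ℓ ≤ d * T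
    · have h1 := lintegral_empirical_error_le_dyadic hx hw hσ hT hnoise hw_int hw2 hF hfstar hbasic hγ
        0 (by simpa using hL)
      refine (h1.trans ?_).trans le_self_add
      rw [hterm1, show (128 : ℝ≥0∞) = ((128 : ℝ≥0) : ℝ≥0∞) by norm_num, hterm3,
        ← ENNReal.ofReal_add (by positivity) (by positivity)]
      refine ENNReal.ofReal_le_ofReal ?_
      simp only [zero_add, Finset.range_one, Finset.sum_singleton, pow_zero, div_one, ← hℓ]
      have h2 : √ℓ ≤ √d * √T := by
        rw [← Real.sqrt_mul (by positivity)]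
        exact Real.sqrt_le_sqrt hd
      have h3 : 12 * ((σ : ℝ) / √T) * (γ * √ℓ) ≤ 12 * ((σ : ℝ) / √T) * (γ * (√d * √T)) := by
        gcongr
      have h4 : 12 * ((σ : ℝ) / √T) * (γ * (√d * √T)) = 12 * (σ * √d) * γ := by
        have : 0 < √(T : ℝ) := Real.sqrt_pos.2 hT'
        field_simp
      have h5 : 0 ≤ σ * √d := by positivity
      have h6 : ((128 : ℝ≥0) : ℝ) = 128 := rfl
      rw [h6]
      nlinarith [mul_le_mul_of_nonneg_left hα.le h5, mul_nonneg h5 hγ'.le]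
    · refine (hcrude.trans ?_).trans (le_self_add.trans le_self_add)
      rw [hterm1]
      refine ENNReal.ofReal_le_ofReal ?_
      rw [le_div_iff₀ hT']
      push Not at hd
      have : (σ : ℝ) ^ 2 * (d * T) ≤ σ ^ 2 * ℓ := by gcongr
      linarith
  push Not at hα
  -- The finest net has scale `γ / 2^J`, but the integral must reach half of that. The chaining
  -- constant is `12 · 2 = 24 ≤ 64`.
  have hdy : ∀ J : ℕ, (α : ℝ) ≤ γ / 2 ^ (J + 1) → A ≤ 8 * (σ : ℝ≥0∞) ^ 2 * metricEntropy F γ / T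
      + 6 * ((γ / 2 ^ J : ℝ≥0) : ℝ≥0∞) * σ * (d : ℝ≥0∞) ^ (1 / 2 : ℝ)
      + 64 * ((σ : ℝ≥0∞) / (T : ℝ≥0∞) ^ (1 / 2 : ℝ)) * I := by
    intro J hJ
    have hsum : ∑ j ∈ Finset.range (J + 1), ENNReal.ofReal ((γ : ℝ) / 2 ^ j) * φ ((γ : ℝ) / 2 ^ j)
        ≤ 2 * I := by
      refine (sum_dyadic_le_lintegral hφ_anti hγ'.le J).trans ?_
      exact mul_le_mul_right (lintegral_mono_set (Set.Ioc_subset_Ioc_left hJ)) 2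
    -- An infinite entropy at one of these scales would make `I` infinite.
    have hent : ∀ j ≤ J, metricEntropy F (γ / 2 ^ j) ≠ ⊤ := by
      intro j hj htop
      have h1 := (Finset.single_le_sum (f := fun j => ENNReal.ofReal ((γ : ℝ) / 2 ^ j)
        * φ ((γ : ℝ) / 2 ^ j)) (fun _ _ => zero_le) (Finset.mem_range.2 (Nat.lt_succ_of_le hj))).trans
        hsum
      rw [hφγ, htop, ENNReal.top_rpow_of_pos (by norm_num), ENNReal.mul_top, top_le_iff] at h1
      · exact ENNReal.mul_ne_top (by norm_num) hItop h1
      · exact (ENNReal.ofReal_pos.2 (by positivity)).ne'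
    refine (lintegral_empirical_error_le_dyadic hx hw hσ hT hnoise hw_int hw2 hF hfstar hbasic hγ
        J hent).trans ?_
    rw [add_right_comm, hterm1]
    refine ENNReal.ofReal_add_le.trans (add_le_add (ENNReal.ofReal_add_le.trans
      (add_le_add le_rfl (le_of_eq ?_))) ?_)
    rotate_left
    · rw [ENNReal.ofReal_mul (by positivity), ENNReal.ofReal_mul (by positivity),
        ENNReal.ofReal_div_of_pos (Real.sqrt_pos.2 hT'), ofReal_sqrt_natCast,
        ENNReal.ofReal_coe_nnreal, ENNReal.ofReal_sum_of_nonneg fun j _ => by positivity]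
      have h1 : ∑ j ∈ Finset.range (J + 1), ENNReal.ofReal ((γ : ℝ) / 2 ^ j
          * √(metricEntropy F (γ / 2 ^ j)).toReal) ≤ 2 * I := by
        refine le_trans (le_of_eq (Finset.sum_congr rfl fun j hj => ?_)) hsum
        rw [ENNReal.ofReal_mul (by positivity), hφγ,
          ofReal_sqrt_toReal (hent j (Nat.lt_succ_iff.1 (Finset.mem_range.1 hj)))]
      refine (mul_le_mul_right h1 _).trans ?_
      rw [← mul_assoc, mul_right_comm _ _ (2 : ℝ≥0∞)]
      gcongr
      rw [show (64 : ℝ≥0∞) = ENNReal.ofReal 64 by simp, show (2 : ℝ≥0∞) = ENNReal.ofReal 2 by simp,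
        ← ENNReal.ofReal_mul (by norm_num)]
      exact ENNReal.ofReal_le_ofReal (by norm_num)
    · rw [show (6 : ℝ≥0∞) = ((6 : ℝ≥0) : ℝ≥0∞) by norm_num, hterm3]
      push_cast
      rfl
  rcases eq_or_ne α 0 with rfl | hα0
  · have hlim : Filter.Tendsto (fun J : ℕ => 8 * (σ : ℝ≥0∞) ^ 2 * metricEntropy F γ / T
      + 6 * ((γ / 2 ^ J : ℝ≥0) : ℝ≥0∞) * σ * (d : ℝ≥0∞) ^ (1 / 2 : ℝ)
      + 64 * ((σ : ℝ≥0∞) / (T : ℝ≥0∞) ^ (1 / 2 : ℝ)) * I) Filter.atTop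
      (nhds (8 * (σ : ℝ≥0∞) ^ 2 * metricEntropy F γ / T
      + 6 * ((0 : ℝ≥0) : ℝ≥0∞) * σ * (d : ℝ≥0∞) ^ (1 / 2 : ℝ)
      + 64 * ((σ : ℝ≥0∞) / (T : ℝ≥0∞) ^ (1 / 2 : ℝ)) * I)) := by
      refine (tendsto_const_nhds.add ?_).add tendsto_const_nhds
      refine ENNReal.Tendsto.mul_const (ENNReal.Tendsto.mul_const (ENNReal.Tendsto.const_mul
        (ENNReal.tendsto_coe.2 ?_) (Or.inr (by norm_num))) (Or.inr ENNReal.coe_ne_top))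
        (Or.inr (ENNReal.rpow_ne_top_of_nonneg (by norm_num) (ENNReal.natCast_ne_top d)))
      have := (tendsto_pow_atTop_nhds_zero_of_lt_one (r := (1 / 2 : ℝ≥0)) (zero_le)
        (by rw [div_lt_one] <;> norm_num)).const_mul γ
      simpa [div_eq_mul_inv] using this
    refine (ge_of_tendsto' hlim fun J => hdy J (by simp; positivity)).trans ?_
    simp
  · have hα' : (0 : ℝ) < α := by exact_mod_cast pos_iff_ne_zero.2 hα0
    -- With `2^n ≤ γ/α < 2^(n+1)` and `n = J + 1`, the finest scale is below `4α`, and `6 · 4 ≤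
    -- 128`. The case `n = 0` would mean `γ < 2α`.
    obtain ⟨n, hn1, hn2⟩ := exists_nat_pow_near (x := (γ : ℝ) / α) (y := 2)
      (by rw [one_le_div hα']; exact_mod_cast hαγ) (by norm_num)
    rw [le_div_iff₀ hα'] at hn1
    rw [div_lt_iff₀ hα'] at hn2
    rcases n with _ | J
    · norm_num at hn2
      linarith
    refine (hdy J (by rw [le_div_iff₀ (by positivity)]; linarith)).trans ?_
    refine add_le_add (add_le_add le_rfl ?_) le_rfl
    rw [show (6 : ℝ≥0∞) = ((6 : ℝ≥0) : ℝ≥0∞) by norm_num,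
      show (128 : ℝ≥0∞) = ((128 : ℝ≥0) : ℝ≥0∞) by norm_num, hterm3, hterm3]
    refine ENNReal.ofReal_le_ofReal ?_
    have h1 : (γ : ℝ) / 2 ^ J ≤ 4 * α := by
      rw [div_le_iff₀ (by positivity)]
      rw [pow_succ, pow_succ] at hn2
      linarith
    have h2 : 6 * ((γ : ℝ) / 2 ^ J) ≤ 128 * α := by linarith
    push_cast
    gcongr

end EmpiricalErrorENNReal

/-! ### The fresh draw and the population error. -/

theorem lintegral_comp_prodMk_of_indepFun {Ω Ω' X : Type*} {mΩ : MeasurableSpace Ω}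
    {P : Measure Ω} [IsProbabilityMeasure P] [MeasurableSpace Ω'] [MeasurableSpace X] {φ : Ω → Ω'}
    {ξ : Ω → X} (hφ : Measurable φ) (hξ : Measurable ξ) (hind : IndepFun φ ξ P)
    {g : Ω' × X → ℝ≥0∞} (hg : Measurable g) :
    ∫⁻ ω, g (φ ω, ξ ω) ∂P = ∫⁻ ω, ∫⁻ u, g (φ ω, u) ∂(P.map ξ) ∂P := by
  have : IsProbabilityMeasure (P.map ξ) := Measure.isProbabilityMeasure_map hξ.aemeasurable
  have : IsProbabilityMeasure (P.map φ) := Measure.isProbabilityMeasure_map hφ.aemeasurable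
  have h := (indepFun_iff_map_prod_eq_prod_map_map hφ.aemeasurable hξ.aemeasurable).1 hind
  rw [← lintegral_map (f := g) hg (hφ.prodMk hξ), h, lintegral_prod _ hg.aemeasurable,
    lintegral_map hg.lintegral_prod_right' hφ]

/-- Averaging out a draw that is independent of the sub-σ-algebra `m`. -/
theorem lintegral_comp_of_indep {Ω X : Type*} {m : MeasurableSpace Ω} {mΩ : MeasurableSpace Ω}
    {P : Measure Ω} [IsProbabilityMeasure P] [mX : MeasurableSpace X] (hm : m ≤ mΩ) {ξ : Ω → X}
    (hξ : Measurable ξ) (hind : Indep m (MeasurableSpace.comap ξ mX) P) {g : Ω × X → ℝ≥0∞}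
    (hg : Measurable[m.prod mX] g) :
    ∫⁻ ω, g (ω, ξ ω) ∂P = ∫⁻ ω, ∫⁻ u, g (ω, u) ∂(P.map ξ) ∂P := by
  have hid : @Measurable Ω Ω mΩ m id := measurable_id'' hm
  have hind' : @IndepFun Ω Ω X mΩ m mX id ξ P := by
    refine (IndepFun_iff_Indep (mβ := m) (mγ := mX) id ξ P).2 ?_
    rw [MeasurableSpace.comap_id]
    exact hind
  exact @lintegral_comp_prodMk_of_indepFun Ω Ω X mΩ P _ m mX id ξ hid hξ hind' g hg

theorem lintegral_covariateMixture {Ω X : Type*} {mΩ : MeasurableSpace Ω} [MeasurableSpace X]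
    (P : Measure Ω) {T : ℕ} {x : Fin T → Ω → X} (hx : ∀ t, Measurable (x t)) {g : X → ℝ≥0∞}
    (hg : Measurable g) :
    ∫⁻ u, g u ∂(covariateMixture P x) = (T : ℝ≥0∞)⁻¹ * ∑ t, ∫⁻ ω, g (x t ω) ∂P := by
  rw [covariateMixture, lintegral_smul_measure, lintegral_finsetSum_measure, smul_eq_mul]
  congr 1
  exact Finset.sum_congr rfl fun t _ => lintegral_map hg (hx t)

theorem isProbabilityMeasure_covariateMixture {Ω X : Type*} {mΩ : MeasurableSpace Ω}
    [MeasurableSpace X] (P : Measure Ω) [IsProbabilityMeasure P] {T : ℕ} (hT : 0 < T)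
    {x : Fin T → Ω → X} (hx : ∀ t, Measurable (x t)) :
    IsProbabilityMeasure (covariateMixture P x) := by
  constructor
  have h := lintegral_covariateMixture P hx (g := fun _ => 1) measurable_const
  rw [lintegral_one] at h
  rw [h]
  simp only [lintegral_one, measure_univ, Finset.sum_const, Finset.card_univ, Fintype.card_fin,
    nsmul_eq_mul, mul_one]
  exact ENNReal.inv_mul_cancel (by exact_mod_cast hT.ne') (ENNReal.natCast_ne_top T)

/-- The sign is reversed because the population error has to be bounded by the empirical one, so
downward deviations matter. -/
theorem IsSubgaussian.lintegral_exp_map_le {Ω Ω' : Type*} {mΩ : MeasurableSpace Ω}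
    [MeasurableSpace Ω'] {P : Measure Ω} {Z : Ω → Ω'} (hZ : Measurable Z) {U : Ω' → ℝ}
    (hU : Measurable U) {v : ℝ≥0} (h : IsSubgaussian (P.map Z) U v) (l : ℝ) :
    ∫⁻ ω, ENNReal.ofReal (Real.exp (l * (∫ ω', U (Z ω') ∂P - U (Z ω)))) ∂P
      ≤ ENNReal.ofReal (Real.exp (l ^ 2 * v / 2)) := by
  have e : ∫ z, U z ∂(P.map Z) = ∫ ω, U (Z ω) ∂P :=
    integral_map hZ.aemeasurable hU.aestronglyMeasurable
  have hi := h.integrable_exp_mul (-l)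
  have hm := h.mgf_le (-l)
  rw [mgf] at hm
  have hg : ∀ z, ENNReal.ofReal (Real.exp (-l * (U z - ∫ z', U z' ∂(P.map Z))))
      = ENNReal.ofReal (Real.exp (l * (∫ ω', U (Z ω') ∂P - U z))) := by
    intro z
    rw [e]
    congr 2
    ring
  have h1 : ∫⁻ ω, ENNReal.ofReal (Real.exp (l * (∫ ω', U (Z ω') ∂P - U (Z ω)))) ∂P
      = ∫⁻ z, ENNReal.ofReal (Real.exp (-l * (U z - ∫ z', U z' ∂(P.map Z)))) ∂(P.map Z) := by
    simp_rw [hg]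
    rw [lintegral_map (by fun_prop) hZ]
  rw [h1, ← ofReal_integral_eq_lintegral_ofReal hi (.of_forall fun _ => (Real.exp_pos _).le)]
  refine ENNReal.ofReal_le_ofReal (hm.trans (le_of_eq ?_))
  congr 1
  ring

/-- Maximal inequality for a finite family of subgaussian variables. -/
theorem exists_subgaussian_dominating {Ω β : Type*} {mΩ : MeasurableSpace Ω} {P : Measure Ω}
    [IsProbabilityMeasure P] (C : Finset β) {V : β → Ω → ℝ} (hV : ∀ k ∈ C, Measurable (V k))
    {v H : ℝ} (hv : 0 < v) (hH : 0 < H) (hcard : (C.card : ℝ) ≤ Real.exp H)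
    (hexp : ∀ k ∈ C, ∀ l : ℝ, ∫⁻ ω, ENNReal.ofReal (Real.exp (l * V k ω)) ∂P
      ≤ ENNReal.ofReal (Real.exp (l ^ 2 * v / 2))) :
    ∃ R : Ω → ℝ, Integrable R P ∧ (∀ k ∈ C, ∀ ω, V k ω ≤ R ω) ∧ ∫ ω, R ω ∂P ≤ √(2 * v * H) := by
  set q := √(2 * v * H) with hq
  have hq0 : 0 < q := by positivity
  have hq2 : q ^ 2 = 2 * v * H := Real.sq_sqrt (by positivity)
  obtain ⟨R, h1, h2, h3⟩ := exists_integrable_dominating (P := P) C hV (μ := q / v)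
    (by positivity) hcard (fun k hk => hexp k hk (q / v))
  refine ⟨R, h1, h2, h3.trans (le_of_eq ?_)⟩
  have hH' : H = q ^ 2 / (2 * v) := by rw [hq2]; field_simp
  rw [hH']
  field_simp
  ring

/-- With `g` a net point near `fhat ω`, replacing `fhat` by `g` costs `δ` under the mixture and
another `δ` along the trajectory. For `g` itself the gap is `𝔼 U_g - U_g`, dominated uniformly over
the net. -/
theorem lintegral_population_error_le {Ω X : Type*} {mΩ : MeasurableSpace Ω} {P : Measure Ω}
    [IsProbabilityMeasure P] [MeasurableSpace X] {T d : ℕ} (hT : 0 < T) {x : Fin T → Ω → X}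
    (hx : ∀ t, Measurable (x t)) {F : Set (X → EuclideanSpace ℝ (Fin d))}
    (hF : ∀ f ∈ F, Measurable f)
    (hF_metric : ∀ f ∈ F, ∀ g ∈ F, ∃ C : ℝ, ∀ u : X, ‖f u - g u‖ ≤ C)
    {fstar : X → EuclideanSpace ℝ (Fin d)} (hfstar : fstar ∈ F) {v : ℝ≥0}
    (hv : ∀ f ∈ F, ∀ l : ℝ, ∫⁻ ω, ENNReal.ofReal (Real.exp
      (l * (∫ ω', (1 / (T : ℝ)) * ∑ t, ‖f (x t ω') - fstar (x t ω')‖ ∂P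
        - (1 / (T : ℝ)) * ∑ t, ‖f (x t ω) - fstar (x t ω)‖))) ∂P
      ≤ ENNReal.ofReal (Real.exp (l ^ 2 * v / 2)))
    {fhat : Ω → X → EuclideanSpace ℝ (Fin d)} (hfhat : ∀ᵐ ω ∂P, fhat ω ∈ F)
    (hfhat_meas : ∀ t, Measurable fun ω => fhat ω (x t ω))
    {δ : ℝ≥0} (hδ : metricEntropy F δ ≠ ⊤) :
    ∫⁻ ω, ∫⁻ u, ‖fhat ω u - fstar u‖ₑ ∂(covariateMixture P x) ∂P
      ≤ ∫⁻ ω, ENNReal.ofReal ((1 / (T : ℝ)) * ∑ t, ‖fhat ω (x t ω) - fstar (x t ω)‖) ∂P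
        + 2 * (δ : ℝ≥0∞) + (2 * (v : ℝ≥0∞) * metricEntropy F δ) ^ (1 / 2 : ℝ) := by
  have hT' : (0 : ℝ) < T := by exact_mod_cast hT
  have := isProbabilityMeasure_covariateMixture P hT hx
  obtain ⟨C, hCF, hC, hcard⟩ := exists_finset_cover_of_metricEntropy_ne_top ⟨fstar, hfstar⟩ hδ
  set ℓ := (metricEntropy F δ).toReal with hℓ
  have hℓ0 : 0 ≤ ℓ := ENNReal.toReal_nonneg
  set A : Ω → ℝ := fun ω => (1 / (T : ℝ)) * ∑ t, ‖fhat ω (x t ω) - fstar (x t ω)‖ with hA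
  have hfstar_meas := hF fstar hfstar
  have hA_meas : Measurable A := (Finset.measurable_fun_sum _ fun t _ =>
    ((hfhat_meas t).sub (hfstar_meas.comp (hx t))).norm).const_mul _
  have hA0 : ∀ ω, 0 ≤ A ω := fun ω => by positivity
  by_cases hAtop : ∫⁻ ω, ENNReal.ofReal (A ω) ∂P = ⊤
  · rw [hAtop, top_add, top_add]
    exact le_top
  have hA_int : Integrable A P := ⟨hA_meas.aestronglyMeasurable, by
    rw [hasFiniteIntegral_iff_ofReal (.of_forall hA0)]
    exact lt_top_iff_ne_top.2 hAtop⟩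
  set U : (X → EuclideanSpace ℝ (Fin d)) → Ω → ℝ :=
    fun f ω => (1 / (T : ℝ)) * ∑ t, ‖f (x t ω) - fstar (x t ω)‖ with hU
  have hU_meas : ∀ f ∈ F, Measurable (U f) := fun f hf => (Finset.measurable_fun_sum _ fun t _ =>
    (((hF f hf).comp (hx t)).sub (hfstar_meas.comp (hx t))).norm).const_mul _
  have hU0 : ∀ f ω, 0 ≤ U f ω := fun f ω => by positivity
  have hU_int : ∀ f ∈ F, Integrable (U f) P := by
    intro f hf
    obtain ⟨B, hB⟩ := hF_metric f hf fstar hfstar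
    refine (integrable_finsetSum _ fun t _ => ?_).const_mul _
    refine Integrable.of_bound (C := B) (((hF f hf).comp (hx t)).sub
      (hfstar_meas.comp (hx t))).norm.aestronglyMeasurable (.of_forall fun ω => ?_)
    rw [norm_norm]
    exact hB _
  have hU_mix : ∀ f ∈ F, ∫⁻ u, ‖f u - fstar u‖ₑ ∂(covariateMixture P x)
      = ENNReal.ofReal (∫ ω, U f ω ∂P) := by
    intro f hf
    rw [lintegral_covariateMixture P hx (g := fun u => ‖f u - fstar u‖ₑ)
        ((hF f hf).sub hfstar_meas).enorm,
      ofReal_integral_eq_lintegral_ofReal (hU_int f hf) (.of_forall (hU0 f)),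
      ← lintegral_finsetSum (f := fun t ω => ‖f (x t ω) - fstar (x t ω)‖ₑ) _ fun t _ => (((hF f hf).comp (hx t)).sub
        (hfstar_meas.comp (hx t))).enorm,
      ← lintegral_const_mul' _ _ (ENNReal.inv_ne_top.2 (by exact_mod_cast hT.ne'))]
    refine lintegral_congr fun ω => ?_
    rw [hU, ENNReal.ofReal_mul (by positivity), ENNReal.ofReal_sum_of_nonneg fun t _ => norm_nonneg _,
      one_div, ENNReal.ofReal_inv_of_pos hT', ENNReal.ofReal_natCast]
    simp only [ofReal_norm]
  have hmain : ∀ η : ℝ, 0 < η → ∫⁻ ω, ∫⁻ u, ‖fhat ω u - fstar u‖ₑ ∂(covariateMixture P x) ∂P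
      ≤ ∫⁻ ω, ENNReal.ofReal (A ω) ∂P + 2 * (δ : ℝ≥0∞)
        + ENNReal.ofReal √(2 * (v + η) * (ℓ + η)) := by
    -- The variance and the entropy may both vanish; raising each by `η` meets the positivity
    -- requirements, and `η → 0` at the end.
    intro η hη
    obtain ⟨R, hR, hR1, hR2⟩ := exists_subgaussian_dominating (P := P) C
      (V := fun f ω => ∫ ω', U f ω' ∂P - U f ω) (v := v + η) (H := ℓ + η)
      (fun f hf => (hU_meas f (hCF f hf)).const_sub _) (by positivity) (by positivity)
      (hcard.trans (Real.exp_le_exp.2 (by linarith)))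
      (fun f hf l => (hv f (hCF f hf) l).trans (ENNReal.ofReal_le_ofReal (Real.exp_le_exp.2 (by
        have : 0 ≤ l ^ 2 * η := by positivity
        linarith))))
    have hpt : ∀ᵐ ω ∂P, ∫⁻ u, ‖fhat ω u - fstar u‖ₑ ∂(covariateMixture P x)
        ≤ (δ : ℝ≥0∞) + ENNReal.ofReal (A ω + δ + R ω) ∧ 0 ≤ A ω + δ + R ω := by
      filter_upwards [hfhat] with ω hω
      obtain ⟨g, hg, hgd⟩ := hC _ hω
      have h1 : ∫⁻ u, ‖fhat ω u - fstar u‖ₑ ∂(covariateMixture P x)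
          ≤ (δ : ℝ≥0∞) + ENNReal.ofReal (∫ ω, U g ω ∂P) := by
        rw [← hU_mix g (hCF g hg)]
        calc _ ≤ ∫⁻ u, ((δ : ℝ≥0∞) + ‖g u - fstar u‖ₑ) ∂(covariateMixture P x) := by
              refine lintegral_mono fun u => ?_
              rw [← sub_add_sub_cancel (fhat ω u) (g u) (fstar u)]
              refine (enorm_add_le _ _).trans (add_le_add ?_ le_rfl)
              have h2 : ‖fhat ω u - g u‖₊ ≤ δ := by exact_mod_cast hgd u
              exact_mod_cast h2
          _ = _ := by
              rw [lintegral_add_left measurable_const, lintegral_const, measure_univ, mul_one]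
      have h2 : U g ω ≤ A ω + δ := by
        have h3 : ∑ t, ‖g (x t ω) - fstar (x t ω)‖
            ≤ ∑ t, (‖fhat ω (x t ω) - fstar (x t ω)‖ + (δ : ℝ)) := by
          refine Finset.sum_le_sum fun t _ => ?_
          have h4 := norm_add_le (fhat ω (x t ω) - fstar (x t ω)) (g (x t ω) - fhat ω (x t ω))
          rw [sub_add_sub_cancel', norm_sub_rev (g (x t ω)) (fhat ω (x t ω))] at h4
          exact h4.trans (add_le_add le_rfl (hgd _))
        rw [Finset.sum_add_distrib, Finset.sum_const, Finset.card_univ, Fintype.card_fin,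
          nsmul_eq_mul] at h3
        have h5 := mul_le_mul_of_nonneg_left h3 (show 0 ≤ 1 / (T : ℝ) by positivity)
        rw [mul_add, ← mul_assoc (1 / (T : ℝ)), one_div_mul_cancel hT'.ne', one_mul] at h5
        exact h5
      have h3 := hR1 g hg ω
      have h4 : ∫ ω, U g ω ∂P ≤ A ω + δ + R ω := by linarith
      exact ⟨h1.trans (add_le_add le_rfl (ENNReal.ofReal_le_ofReal h4)),
        (integral_nonneg (hU0 g)).trans h4⟩
    have hAδ : Integrable (fun ω => A ω + δ) P := hA_int.add (integrable_const _)
    have hAδR : Integrable (fun ω => A ω + δ + R ω) P := hAδ.add hR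
    calc _ ≤ ∫⁻ ω, ((δ : ℝ≥0∞) + ENNReal.ofReal (A ω + δ + R ω)) ∂P :=
          lintegral_mono_ae (hpt.mono fun ω h => h.1)
      _ = δ + ENNReal.ofReal (∫ ω, (A ω + δ + R ω) ∂P) := by
          rw [lintegral_add_left measurable_const, lintegral_const, measure_univ, mul_one,
            ofReal_integral_eq_lintegral_ofReal hAδR (hpt.mono fun ω h => h.2)]
      _ ≤ δ + (ENNReal.ofReal (∫ ω, A ω ∂P) + δ
            + ENNReal.ofReal √(2 * (v + η) * (ℓ + η))) := by
          rw [integral_add hAδ hR, integral_add hA_int (integrable_const _), integral_const,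
            probReal_univ, one_smul]
          refine add_le_add le_rfl (ENNReal.ofReal_add_le.trans (add_le_add
            (ENNReal.ofReal_add_le.trans (add_le_add le_rfl ?_)) (ENNReal.ofReal_le_ofReal hR2)))
          rw [ENNReal.ofReal_coe_nnreal]
      _ = _ := by
          rw [ofReal_integral_eq_lintegral_ofReal hA_int (.of_forall hA0), two_mul]
          ring
  have hlim : Filter.Tendsto (fun η : ℝ => ∫⁻ ω, ENNReal.ofReal (A ω) ∂P + 2 * (δ : ℝ≥0∞)
        + ENNReal.ofReal √(2 * (v + η) * (ℓ + η))) (nhdsWithin 0 (Set.Ioi 0))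
      (nhds (∫⁻ ω, ENNReal.ofReal (A ω) ∂P + 2 * (δ : ℝ≥0∞)
        + ENNReal.ofReal √(2 * (v + 0) * (ℓ + 0)))) := by
    refine tendsto_const_nhds.add (ENNReal.tendsto_ofReal (Filter.Tendsto.mono_left
      (Continuous.tendsto ?_ 0) nhdsWithin_le_nhds))
    fun_prop
  refine (ge_of_tendsto hlim (Filter.eventually_of_mem self_mem_nhdsWithin hmain)).trans
    (add_le_add le_rfl (le_of_eq ?_))
  have e : (2 : ℝ) * (v + 0) * (ℓ + 0) = (2 * (v : ℝ≥0∞) * metricEntropy F δ).toReal := by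
    rw [ENNReal.toReal_mul, ENNReal.toReal_mul, ← hℓ]
    simp
  rw [e, ofReal_sqrt_toReal]
  exact ENNReal.mul_ne_top (ENNReal.mul_ne_top (by norm_num) ENNReal.coe_ne_top) hδ

/-! ### Assembly of the risk bound. -/

theorem measurable_enorm_sub_comp_snd {Ω X E : Type*} (m : MeasurableSpace Ω)
    [mX : MeasurableSpace X] [NormedAddCommGroup E] [MeasurableSpace E] [BorelSpace E]
    [SecondCountableTopology E] {g : Ω × X → E} (hg : Measurable[m.prod mX] g) {f : X → E}
    (hf : Measurable f) : Measurable[m.prod mX] fun p => ‖g p - f p.2‖ₑ :=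
  (hg.sub (hf.comp measurable_snd)).enorm

/-- Here `ℱ t` plays the role of `𝓕_{t-1}`, so `x t` is `ℱ t`-measurable and `w t` is
`ℱ (t + 1)`-measurable; `𝒢` collects all randomness other than `ξ` (the trajectory and the
randomness of the algorithm). -/
theorem theorem1
    {Ω : Type*} (𝒢 : MeasurableSpace Ω) {mΩ : MeasurableSpace Ω} (P : Measure Ω) [IsProbabilityMeasure P]
    {T dx dy : ℕ} (hT : 0 < T)
    -- the covariate space and the hypothesis class
    (X : Set (EuclideanSpace ℝ (Fin dx)))
    (F : Set (X → EuclideanSpace ℝ (Fin dy)))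
    (hF_meas : ∀ f ∈ F, Measurable f)
    (hF_metric : ∀ f ∈ F, ∀ g ∈ F, ∃ C : ℝ, ∀ u : X, ‖f u - g u‖ ≤ C)
    -- the time-series model
    (fstar : X → EuclideanSpace ℝ (Fin dy)) (hfstar : fstar ∈ F)
    (ℱ : Filtration ℕ mΩ)
    (x : Fin T → Ω → X) (w y : Fin T → Ω → EuclideanSpace ℝ (Fin dy))
    (hx : ∀ t : Fin T, Measurable[ℱ (t : ℕ)] (x t))
    (hw : ∀ t : Fin T, Measurable[ℱ ((t : ℕ) + 1)] (w t))
    (hy : ∀ (t : Fin T) (ω : Ω), y t ω = fstar (x t ω) + w t ω)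
    (σw : ℝ≥0)
    (hw_mds : ∀ t : Fin T, P[w t | ℱ (t : ℕ)] =ᵐ[P] 0)
    (hw_subG : ∀ t : Fin T, IsCondSubgaussian (ℱ (t : ℕ)) P (w t) (σw ^ 2))
    -- the class is subgaussian with respect to the dynamics
    (σT2 : ℝ≥0∞)
    (hσT2 : σT2 = varianceProxy F (P.map (fun ω => (fun t => x t ω, fun t => y t ω))))
    (hσT2_fin : σT2 ≠ ⊤)
    -- the least squares estimator
    (h𝒢 : 𝒢 ≤ mΩ) (hℱ𝒢 : ∀ t : ℕ, ℱ t ≤ 𝒢)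
    (fhat : Ω → X → EuclideanSpace ℝ (Fin dy))
    (hfhat_meas : Measurable[𝒢.prod inferInstance] (fun p : Ω × X => fhat p.1 p.2))
    (hfhat : ∀ᵐ ω ∂P, IsLSE F (fun t => x t ω) (fun t => y t ω) (fhat ω))
    -- the fresh draw
    (ξ : Ω → X) (hξ_meas : Measurable ξ)
    (hξ_law : P.map ξ = covariateMixture P x)
    (hξ_indep : Indep 𝒢 (MeasurableSpace.comap ξ inferInstance) P)
    -- the scales
    (δ γ α : ℝ≥0) (hδ : 0 < δ) (hγ : 0 < γ) (hαγ : α ≤ γ)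
    (hδ_fin : metricEntropy F δ ≠ ⊤) :
    ∫⁻ ω, ‖fhat ω (ξ ω) - fstar (ξ ω)‖ₑ ∂P ≤
      (8 * (σw : ℝ≥0∞) ^ 2 * metricEntropy F γ / (T : ℝ≥0∞)
        + 128 * (α : ℝ≥0∞) * (σw : ℝ≥0∞) * (dy : ℝ≥0∞) ^ (1 / 2 : ℝ)
        + 64 * ((σw : ℝ≥0∞) / (T : ℝ≥0∞) ^ (1 / 2 : ℝ))
          * ∫⁻ s in Set.Ioc (α : ℝ) (γ : ℝ), metricEntropy F s.toNNReal ^ (1 / 2 : ℝ))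
          ^ (1 / 2 : ℝ)
      + 3 * (δ : ℝ≥0∞)
      + (2 * σT2 * metricEntropy F δ) ^ (1 / 2 : ℝ) := by

  have hxm : ∀ t, Measurable (x t) := fun t => (hx t).mono (ℱ.le _) le_rfl
  have hwm : ∀ t, Measurable (w t) := fun t => (hw t).mono (ℱ.le _) le_rfl
  have hfstar_meas := hF_meas fstar hfstar
  have hym : ∀ t, Measurable (y t) := by
    intro t
    rw [show y t = fun ω => fstar (x t ω) + w t ω from funext (hy t)]
    exact (hfstar_meas.comp (hxm t)).add (hwm t)
  have hstep : ∀ t : Fin T, ∀ h : Ω → EuclideanSpace ℝ (Fin dy), Measurable[ℱ (t : ℕ)] h →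
      ∀ G : Ω → ℝ≥0∞, Measurable[ℱ (t : ℕ)] G →
      ∫⁻ ω, G ω * ENNReal.ofReal (Real.exp (inner ℝ (w t ω) (h ω)
        - ((σw ^ 2 : ℝ≥0) : ℝ) / 2 * ‖h ω‖ ^ 2)) ∂P ≤ ∫⁻ ω, G ω ∂P :=
    fun t h hh G hG => (hw_subG t).lintegral_mul_exp_le (ℱ.le _) (hwm t) (hw_mds t) hh hG
  have hnoise : ∀ k : X → EuclideanSpace ℝ (Fin dy), Measurable k → ∫⁻ ω, ENNReal.ofReal (Real.exp
      (∑ t, (inner ℝ (w t ω) (k (x t ω)) - (σw : ℝ) ^ 2 / 2 * ‖k (x t ω)‖ ^ 2))) ∂P ≤ 1 := by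
    intro k hk
    have h := (lintegral_exp_sum_le_one (P := P) ℱ (σw ^ 2) hw hstep
      (h := fun t ω => k (x t ω)) (fun t => hk.comp (hx t))).2
    simpa using h
  have hw2 : ∀ t, ∫⁻ ω, ENNReal.ofReal (‖w t ω‖ ^ 2) ∂P
      ≤ ENNReal.ofReal (2 * (σw : ℝ) ^ 2 * dy) := by
    intro t
    refine lintegral_norm_sq_le (hwm t) σw.coe_nonneg fun c => ?_
    simpa using hstep t (fun _ => c) measurable_const (fun _ => 1) measurable_const
  have hbasic : ∀ᵐ ω ∂P, fhat ω ∈ F ∧ ∑ t, ‖fhat ω (x t ω) - fstar (x t ω)‖ ^ 2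
      ≤ 2 * ∑ t, inner ℝ (w t ω) (fhat ω (x t ω) - fstar (x t ω)) := by
    filter_upwards [hfhat] with ω hω
    exact ⟨hω.1, hω.basic_inequality hT hfstar fun t => hy t ω⟩
  have hfhatm : Measurable fun p : Ω × X => fhat p.1 p.2 :=
    hfhat_meas.mono (sup_le_sup (MeasurableSpace.comap_mono h𝒢) le_rfl) le_rfl
  have hfhat_traj : ∀ t, Measurable fun ω => fhat ω (x t ω) :=
    fun t => hfhatm.comp (measurable_id.prodMk (hxm t))
  have hfresh : ∫⁻ ω, ‖fhat ω (ξ ω) - fstar (ξ ω)‖ₑ ∂P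
      = ∫⁻ ω, ∫⁻ u, ‖fhat ω u - fstar u‖ₑ ∂(covariateMixture P x) ∂P := by
    rw [← hξ_law]
    refine lintegral_comp_of_indep h𝒢 hξ_meas hξ_indep
      (g := fun p : Ω × X => ‖fhat p.1 p.2 - fstar p.2‖ₑ) ?_
    exact measurable_enorm_sub_comp_snd 𝒢 hfhat_meas hfstar_meas
  have hempirical := lintegral_empirical_error_le hxm hwm hT hnoise (fun t => (hw_subG t).1) hw2
    hF_meas hfstar hbasic hγ hαγ
  set B := 8 * (σw : ℝ≥0∞) ^ 2 * metricEntropy F γ / (T : ℝ≥0∞)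
        + 128 * (α : ℝ≥0∞) * (σw : ℝ≥0∞) * (dy : ℝ≥0∞) ^ (1 / 2 : ℝ)
        + 64 * ((σw : ℝ≥0∞) / (T : ℝ≥0∞) ^ (1 / 2 : ℝ))
          * ∫⁻ s in Set.Ioc (α : ℝ) (γ : ℝ), metricEntropy F s.toNNReal ^ (1 / 2 : ℝ) with hB
  -- Jensen in `ω`, then Cauchy-Schwarz in `t`.
  have hL1 : ∫⁻ ω, ENNReal.ofReal ((1 / (T : ℝ)) * ∑ t, ‖fhat ω (x t ω) - fstar (x t ω)‖) ∂P
      ≤ B ^ (1 / 2 : ℝ) := by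
    have hm : Measurable fun ω => (1 / (T : ℝ)) * ∑ t, ‖fhat ω (x t ω) - fstar (x t ω)‖ :=
      (Finset.measurable_fun_sum _ fun t _ =>
        ((hfhat_traj t).sub (hfstar_meas.comp (hxm t))).norm).const_mul _
    refine (lintegral_le_sqrt_lintegral_sq hm.ennreal_ofReal.aemeasurable).trans
      (ENNReal.rpow_le_rpow (le_trans (lintegral_mono fun ω => ?_) hempirical) (by norm_num))
    rw [← ENNReal.ofReal_pow (by positivity)]
    refine ENNReal.ofReal_le_ofReal ?_
    have hT' : (0 : ℝ) < T := by exact_mod_cast hT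
    have h := sq_sum_le_card_mul_sum_sq (s := Finset.univ)
      (f := fun t => ‖fhat ω (x t ω) - fstar (x t ω)‖)
    rw [Finset.card_univ, Fintype.card_fin] at h
    rw [mul_pow]
    refine (mul_le_mul_of_nonneg_left h (by positivity)).trans (le_of_eq ?_)
    field_simp
  have hpop : ∀ v : ℝ≥0, (∀ f ∈ F, ∀ g ∈ F,
      IsSubgaussian (P.map (fun ω => (fun t => x t ω, fun t => y t ω)))
        (fun z => (1 / (T : ℝ)) * ∑ t : Fin T, ‖f (z.1 t) - g (z.1 t)‖) v) →
      ∫⁻ ω, ‖fhat ω (ξ ω) - fstar (ξ ω)‖ₑ ∂P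
        ≤ B ^ (1 / 2 : ℝ) + 3 * (δ : ℝ≥0∞)
          + (2 * (v : ℝ≥0∞) * metricEntropy F δ) ^ (1 / 2 : ℝ) := by
    intro v hv
    rw [hfresh]
    refine (lintegral_population_error_le hT hxm hF_meas hF_metric hfstar (v := v) ?_
      (hbasic.mono fun ω h => h.1) hfhat_traj hδ_fin).trans
      (add_le_add (add_le_add hL1 (mul_le_mul_left (by norm_num) _)) le_rfl)
    intro f hf l
    refine (hv f hf fstar hfstar).lintegral_exp_map_le ?_ ?_ l
    · exact (measurable_pi_lambda _ hxm).prodMk (measurable_pi_lambda _ hym)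
    · have h1 : ∀ t : Fin T, Measurable fun z : (Fin T → X) × (Fin T → EuclideanSpace ℝ (Fin dy)) =>
          z.1 t := fun t => (measurable_pi_apply t).comp measurable_fst
      exact (Finset.measurable_fun_sum _ fun t _ =>
        (((hF_meas f hf).comp (h1 t)).sub (hfstar_meas.comp (h1 t))).norm).const_mul _
  -- To avoid needing the infimum `σT2` to be attained, an admissible proxy below `σT2 + ε` is used
  -- and `ε → 0`; the finite entropy at `δ` makes the bound continuous there.
  have hlim : Filter.Tendsto (fun ε : ℝ≥0 => B ^ (1 / 2 : ℝ) + 3 * (δ : ℝ≥0∞)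
        + (2 * (σT2 + ε) * metricEntropy F δ) ^ (1 / 2 : ℝ)) (nhdsWithin 0 (Set.Ioi 0))
      (nhds (B ^ (1 / 2 : ℝ) + 3 * (δ : ℝ≥0∞)
        + (2 * (σT2 + (0 : ℝ≥0)) * metricEntropy F δ) ^ (1 / 2 : ℝ))) := by
    refine tendsto_const_nhds.add (Filter.Tendsto.ennrpow_const _ (ENNReal.Tendsto.mul_const
      (ENNReal.Tendsto.const_mul (tendsto_const_nhds.add (ENNReal.tendsto_coe.2
        (Filter.tendsto_id.mono_left nhdsWithin_le_nhds))) (Or.inr (by norm_num))) (Or.inr hδ_fin)))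
  rw [ENNReal.coe_zero, add_zero] at hlim
  refine ge_of_tendsto hlim (Filter.eventually_of_mem self_mem_nhdsWithin fun ε hε => ?_)
  have hlt : varianceProxy F (P.map (fun ω => (fun t => x t ω, fun t => y t ω))) < σT2 + ε := by
    rw [← hσT2]
    exact ENNReal.lt_add_right hσT2_fin (by exact_mod_cast (ne_of_gt hε))
  rw [varianceProxy] at hlt
  obtain ⟨v, hlt'⟩ := iInf_lt_iff.1 hlt
  obtain ⟨hv, hvlt⟩ := iInf_lt_iff.1 hlt'
  refine (hpop v hv).trans (add_le_add le_rfl (ENNReal.rpow_le_rpow ?_ (by norm_num)))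
  gcongr
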